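/- Fix an inverse temperature $\beta>0$. For $n\ge 1$ let $\Omega_n=\{0,1,\dots,n\}^n$ be the set of configurations $\eta=(\eta(1),\dots,\eta(n))$ of the $n\times n$ solid-on-solid model, put $\eta(0)=\eta(n+1)=0$, and let $$\mu(\eta)=Z_\beta^{-1}\exp\Bigl(-\beta\sum_{i=1}^{n+1}|\eta(i-1)-\eta(i)|\Bigr)$$ be the Gibbs distribution on $\Omega_n$, where $Z_\beta$ is the normalizing constant. Consider two discrete-time Markov chains on $\Omega_n$, each of which first picks $i\in\{1,\dots,n\}$ uniformly at random. Column dynamics: replace $\eta(i)$ by $j\in\{0,\dots,n\}$ with probability proportional to $\mu(\eta^j)$, where $\eta^j$ is the configuration obtained from $\eta$ by replacing $\eta(i)$ by $j$. Single-site dynamics: let $a=\min\{\eta(i-1),\eta(i+1)\}$ and $b=\max\{\eta(i-1),\eta(i+1)\}$. Replace $\eta(i)$ by $\max\{\eta(i)-1,0\}$ with probability $p^-$, by $\min\{\eta(i)+1,n\}$ with probability $p^+$, and leave $\eta$ unchanged with probability $1-(p^-+p^+)$, where $p^-=\frac14e^{-2\beta}$ if $\eta(i)\le a$ and $p^-=\frac14$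 otherwise, and $p^+=\frac14e^{-2\beta}$ if $\eta(i)\ge b$ and $p^+=\frac14$ otherwise. The mixing time of such a chain is the least $t$ such that, for every initial configuration $\xi\in\Omega_n$, the distribution $\nu_t^\xi$ of the chain at time $t$ satisfies $\|\nu_t^\xi-\mu\|\le \frac1{2e}$ in variation distance $\|\nu-\mu\|=\frac12\sum_{\eta}|\nu(\eta)-\mu(\eta)|$. Theorem. The mixing times of both the column dynamics and the single-site dynamics are $\Omega(n^3)$: there is a constant $c>0$, depending only on $\beta$, such that for every $n\ge 1$ each of the two mixing times is at least $c\,n^3$. -/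

import Mathlib

namespace SOS

/-- Configurations of the `n × n` solid-on-solid model: a height in `{0, …, n}` at each of the
positions `1, …, n`. The element `i : Fin n` stands for the position `i + 1`. -/
abbrev Config (n : ℕ) : Type := Fin n → Fin (n + 1)

/-- The height at position `k`, where the positions are `1, …, n`; outside these (in particular
at `k = 0` and `k = n + 1`) the height is the boundary value `0`. -/
def height {n : ℕ} (η : Config n) (k : ℕ) : ℤ :=
  if h : 1 ≤ k ∧ k ≤ n then ((η ⟨k - 1, by omega⟩ : ℕ) : ℤ) else 0

/-- The energy: the sum over `k = 1, …, n + 1` of `|η(k - 1) - η(k)|`. -/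
def energy {n : ℕ} (η : Config n) : ℤ :=
  ∑ k ∈ Finset.Icc 1 (n + 1), |height η (k - 1) - height η k|

/-- The unnormalized Gibbs weight. -/
noncomputable def weight (β : ℝ) {n : ℕ} (η : Config n) : ℝ :=
  Real.exp (-β * (energy η : ℝ))

/-- The partition function. -/
noncomputable def partitionFunction (β : ℝ) (n : ℕ) : ℝ :=
  ∑ η : Config n, weight β η

/-- The Gibbs distribution. -/
noncomputable def gibbs (β : ℝ) (n : ℕ) (η : Config n) : ℝ :=
  weight β η / partitionFunction β n

/-- The smaller of the heights of the two neighbours of the position of `i`. -/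
def lowNbr {n : ℕ} (η : Config n) (i : Fin n) : ℤ :=
  min (height η i.val) (height η (i.val + 2))

/-- The larger of the heights of the two neighbours of the position of `i`. -/
def highNbr {n : ℕ} (η : Config n) (i : Fin n) : ℤ :=
  max (height η i.val) (height η (i.val + 2))

/-- The configuration with the height at `i` replaced by `max (η i - 1) 0`
(natural-number subtraction). -/
def lower {n : ℕ} (η : Config n) (i : Fin n) : Config n :=
  Function.update η i ⟨(η i).val - 1, by omega⟩

/-- The configuration with the height at `i` replaced by `min (η i + 1) n`. -/
def raise {n : ℕ} (η : Config n) (i : Fin n) : Config n :=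
  Function.update η i ⟨min ((η i).val + 1) n, by omega⟩

/-- The probability of moving down at `i`, once `i` has been picked. -/
noncomputable def probDown (β : ℝ) {n : ℕ} (η : Config n) (i : Fin n) : ℝ :=
  if (((η i).val : ℕ) : ℤ) ≤ lowNbr η i then (1 / 4) * Real.exp (-2 * β) else 1 / 4

/-- The probability of moving up at `i`, once `i` has been picked. -/
noncomputable def probUp (β : ℝ) {n : ℕ} (η : Config n) (i : Fin n) : ℝ :=
  if highNbr η i ≤ (((η i).val : ℕ) : ℤ) then (1 / 4) * Real.exp (-2 * β) else 1 / 4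

/-- The transition matrix of the single-site dynamics: pick a position uniformly at random, then
move its height down by one, up by one, or not at all. -/
noncomputable def singleSite (β : ℝ) (n : ℕ) : Matrix (Config n) (Config n) ℝ :=
  Matrix.of fun η η' =>
    (1 / (n : ℝ)) * ∑ i : Fin n,
      ((if η' = lower η i then probDown β η i else 0)
        + (if η' = raise η i then probUp β η i else 0)
        + (if η' = η then 1 - (probDown β η i + probUp β η i) else 0))

/-- The transition matrix of the column dynamics: pick a position uniformly at random, then
replace its height by `j` with probability proportional to the Gibbs probability of the
resulting configuration. -/
noncomputable def column (β : ℝ) (n : ℕ) : Matrix (Config n) (Config n) ℝ :=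
  Matrix.of fun η η' =>
    (1 / (n : ℝ)) * ∑ i : Fin n, ∑ j : Fin (n + 1),
      if η' = Function.update η i j then
        gibbs β n (Function.update η i j) / ∑ k : Fin (n + 1), gibbs β n (Function.update η i k)
      else 0

/-- Variation distance of two distributions on a finite set. -/
noncomputable def tvDist {Ω : Type*} [Fintype Ω] (p q : Ω → ℝ) : ℝ :=
  (1 / 2) * ∑ x, |p x - q x|

/-- For a Markov chain on a finite set with transition matrix `P` and a distribution `π`:
the least time `t` at which the law of the chain is within variation distance `ε` of `π`,
from every initial state (`⊤` if there is no such time). The law at time `t` from `ξ` is the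
row of `P ^ t` at `ξ`. -/
noncomputable def hitAccuracy {Ω : Type*} [Fintype Ω] [DecidableEq Ω]
    (P : Matrix Ω Ω ℝ) (π : Ω → ℝ) (ε : ℝ) : ℕ∞ :=
  ⨅ t ∈ {t : ℕ | ∀ ξ : Ω, tvDist ((P ^ t) ξ) π ≤ ε}, (t : ℕ∞)

/-- The mixing time: the case `ε = 1 / (2e)`. -/
noncomputable def mixingTime {Ω : Type*} [Fintype Ω] [DecidableEq Ω]
    (P : Matrix Ω Ω ℝ) (π : Ω → ℝ) : ℕ∞ :=
  hitAccuracy P π (1 / (2 * Real.exp 1))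

end SOS

/-! The mixing time of a reversible chain is bounded below by the variance of any test function
divided by its Dirichlet form (`IsReversibleChain.variance_le_mul_time`). The test function is the
total height. For the single-site dynamics each move changes it by at most one, so its Dirichlet
form is bounded. For the column dynamics the form is controlled by the mean squared difference
between neighbouring heights, which is also bounded. It remains to show that the total height has
variance of order n ^ 3.

Both equilibrium estimates are proved for loops instead of configurations. A configuration closed up
through the boundary is a loop whose root is a minimum, that is, an excursion. Weight, area above
the minimum and squared steps are invariant under re-rooting, so a cyclic lemma
(`sum_card_minSet_inter`) exchanges excursions and loops. Passing from loops to excursions loses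
nothing, as every loop has a minimum; the converse costs a factor exp (2 * β), paid by pushing the
root below all other positions (`mul_sum_excursions_le`). Loops are in turn compared with closed
random walks, where generating functions give the second moment of a step and a Chernoff bound shows
that heights of order n are negligible.

The variance bound is of Cramér-Rao type. About n / 100 nested plateaus of height one can be added
to a loop, each altering only two edges and no two altering the same edge. The logarithmic
derivatives of the weight along these shifts are almost uncorrelated, so their sum has second moment
of order n. Each shift should raise the area by an amount of order n, which then forces variance (n
* n) ^ 2 / n = n ^ 3. The difficulty is that the area is measured from the minimum: where all minima
lie on the plateau, the shift lowers the area, and over all loops the two effects cancel to leading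
order. Hence the shifts are localized by a Lipschitz cutoff, a ramp of width of order √n in the gap
between the minimum over the common core of the plateaus and the minimum outside their union. The
cutoff contributes only order √n to the score, and keeps a third of the mass because the gap has no
atom heavier than O(1 / √n) (`sum_fiber_le`, `sum_ramp_ge`, `sq_drift_mul_le`, `area_variance_ge`).
-/

namespace SOS

/-! ### Relaxation-time lower bound for reversible chains -/

section Mixing

variable {Ω : Type*} [Fintype Ω] [DecidableEq Ω]

/-- `P` is a stochastic matrix that is reversible with respect to the distribution `π`. -/
structure IsReversibleChain (P : Matrix Ω Ω ℝ) (π : Ω → ℝ) : Prop where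
  nonneg : ∀ x y, 0 ≤ P x y
  row_sum : ∀ x, ∑ y, P x y = 1
  pi_nonneg : ∀ x, 0 ≤ π x
  pi_sum : ∑ x, π x = 1
  detailed_balance : ∀ x y, π x * P x y = π y * P y x

namespace IsReversibleChain

variable {P : Matrix Ω Ω ℝ} {π : Ω → ℝ}

lemma sum_mulVec (h : IsReversibleChain P π) (u v : Ω → ℝ) :
    ∑ x, π x * (u x * (P.mulVec v) x) = ∑ x, π x * ((P.mulVec u) x * v x) := by
  simp only [Matrix.mulVec, dotProduct, Finset.mul_sum, Finset.sum_mul]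
  rw [Finset.sum_comm]
  refine Finset.sum_congr rfl fun x _ => Finset.sum_congr rfl fun y _ => ?_
  linear_combination (u y * v x) * h.detailed_balance y x

lemma sum_pow_mulVec (h : IsReversibleChain P π) (k : ℕ) (u v : Ω → ℝ) :
    ∑ x, π x * (u x * ((P ^ k).mulVec v) x) = ∑ x, π x * (((P ^ k).mulVec u) x * v x) := by
  induction k generalizing u v with
  | zero => simp
  | succ k ih =>
    rw [pow_succ, ← Matrix.mulVec_mulVec, ih, h.sum_mulVec, Matrix.mulVec_mulVec, ← pow_succ',
      pow_succ]

lemma pow_mulVec_one (h : IsReversibleChain P π) (k : ℕ) :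
    (P ^ k).mulVec (fun _ => (1 : ℝ)) = fun _ => 1 := by
  induction k with
  | zero => simp
  | succ k ih =>
    rw [pow_succ, ← Matrix.mulVec_mulVec]
    have : P.mulVec (fun _ => (1 : ℝ)) = fun _ => 1 := by
      ext x; simp [Matrix.mulVec, dotProduct, h.row_sum]
    rw [this, ih]

lemma mean_pow_mulVec (h : IsReversibleChain P π) (k : ℕ) (u : Ω → ℝ) :
    ∑ x, π x * ((P ^ k).mulVec u) x = ∑ x, π x * u x := by
  have := h.sum_pow_mulVec k (fun _ => 1) u
  simpa [h.pow_mulVec_one k] using this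

lemma abs_pow_mulVec_le (h : IsReversibleChain P π) (k : ℕ) {u : Ω → ℝ} {K : ℝ}
    (hu : ∀ x, |u x| ≤ K) (x : Ω) : |((P ^ k).mulVec u) x| ≤ K := by
  induction k generalizing u with
  | zero => simpa using hu x
  | succ k ih =>
    rw [pow_succ, ← Matrix.mulVec_mulVec]
    refine ih fun y => ?_
    calc |(P.mulVec u) y| ≤ ∑ z, |P y z * u z| := Finset.abs_sum_le_sum_abs _ _
      _ ≤ ∑ z, P y z * K := Finset.sum_le_sum fun z _ => by
          rw [abs_mul, abs_of_nonneg (h.nonneg y z)]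
          exact mul_le_mul_of_nonneg_left (hu z) (h.nonneg y z)
      _ = K := by rw [← Finset.sum_mul, h.row_sum, one_mul]

lemma abs_mulVec_le_of_tvDist {t : ℕ} {ε : ℝ} (ht : ∀ ξ, tvDist ((P ^ t) ξ) π ≤ ε)
    {u : Ω → ℝ} {K : ℝ} (hu : ∀ x, |u x| ≤ K) (hK : 0 ≤ K) (hmean : ∑ x, π x * u x = 0) (x : Ω) :
    |((P ^ t).mulVec u) x| ≤ 2 * ε * K := by
  have h1 : ((P ^ t).mulVec u) x = ∑ y, ((P ^ t) x y - π y) * u y := by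
    simp only [sub_mul, Finset.sum_sub_distrib, hmean, sub_zero]
    rfl
  rw [h1]
  calc |∑ y, ((P ^ t) x y - π y) * u y| ≤ ∑ y, |((P ^ t) x y - π y) * u y| :=
        Finset.abs_sum_le_sum_abs _ _
    _ ≤ ∑ y, |(P ^ t) x y - π y| * K := Finset.sum_le_sum fun y _ => by
        rw [abs_mul]; exact mul_le_mul_of_nonneg_left (hu y) (abs_nonneg _)
    _ = 2 * tvDist ((P ^ t) x) π * K := by rw [← Finset.sum_mul, tvDist]; ring
    _ ≤ 2 * ε * K := by gcongr; exact ht x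

/-- On mean-zero functions `P ^ t` contracts the sup norm by the factor 2 * ε, and it preserves the
mean, so the contraction can be iterated. -/
lemma abs_pow_mul_mulVec_le (h : IsReversibleChain P π) {t : ℕ} {ε : ℝ} (hε : 0 ≤ ε)
    (ht : ∀ ξ, tvDist ((P ^ t) ξ) π ≤ ε)
    {u : Ω → ℝ} {K : ℝ} (hu : ∀ x, |u x| ≤ K) (hK : 0 ≤ K) (hmean : ∑ x, π x * u x = 0)
    (k : ℕ) (x : Ω) : |((P ^ (t * k)).mulVec u) x| ≤ (2 * ε) ^ k * K := by
  induction k generalizing x with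
  | zero => simpa using hu x
  | succ k ih =>
    rw [mul_add_one, add_comm, pow_add, ← Matrix.mulVec_mulVec]
    have := abs_mulVec_le_of_tvDist ht ih (by positivity)
      (by rw [h.mean_pow_mulVec, hmean]) x
    rw [pow_succ]
    linarith

/-- A substitute for the spectral theorem. By Cauchy-Schwarz and self-adjointness, ⟨u, P^k u⟩ ^ 2 ≤
⟨u, u⟩ ⟨u, P^(2k) u⟩, so a Rayleigh quotient of at least r propagates along the powers of two. -/
lemma pow_two_pow_le (h : IsReversibleChain P π) (u : Ω → ℝ) {r : ℝ} (hr : 0 ≤ r)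
    (h1 : r * ∑ x, π x * u x ^ 2 ≤ ∑ x, π x * (u x * (P.mulVec u) x)) (j : ℕ) :
    r ^ (2 ^ j) * ∑ x, π x * u x ^ 2 ≤ ∑ x, π x * (u x * ((P ^ (2 ^ j)).mulVec u) x) := by
  have hV : 0 ≤ ∑ x, π x * u x ^ 2 :=
    Finset.sum_nonneg fun x _ => mul_nonneg (h.pi_nonneg x) (sq_nonneg _)
  induction j with
  | zero => simpa using h1
  | succ j ih =>
    rcases hV.eq_or_lt with h0 | hpos
    · have hz : ∀ x, π x * u x ^ 2 = 0 := fun x =>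
        (Finset.sum_eq_zero_iff_of_nonneg fun x _ =>
          mul_nonneg (h.pi_nonneg x) (sq_nonneg _)).1 h0.symm x (Finset.mem_univ x)
      rw [← h0, mul_zero]
      refine (Finset.sum_eq_zero fun x _ => ?_).ge
      rcases mul_eq_zero.1 (hz x) with h' | h'
      · simp [h']
      · simp [pow_eq_zero_iff (two_ne_zero)] at h'; simp [h']
    set v := (P ^ (2 ^ j)).mulVec u with hv
    have hsq : ∑ x, π x * (u x * ((P ^ (2 ^ (j + 1))).mulVec u) x) = ∑ x, π x * v x ^ 2 := by
      rw [pow_succ 2 j, mul_two, pow_add, ← Matrix.mulVec_mulVec, ← hv, h.sum_pow_mulVec]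
      simp only [← hv, sq]
    have hcs : (∑ x, π x * (u x * v x)) ^ 2 ≤ (∑ x, π x * u x ^ 2) * ∑ x, π x * v x ^ 2 := by
      have := Finset.sum_mul_sq_le_sq_mul_sq Finset.univ
        (fun x => Real.sqrt (π x) * u x) (fun x => Real.sqrt (π x) * v x)
      simp only [mul_pow, Real.sq_sqrt (h.pi_nonneg _)] at this
      refine le_trans (le_of_eq ?_) this
      congr 1
      refine Finset.sum_congr rfl fun x _ => ?_
      have := Real.mul_self_sqrt (h.pi_nonneg x)
      linear_combination (-(u x * v x)) * this
    rw [hsq]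
    have h2 : (r ^ (2 ^ j) * ∑ x, π x * u x ^ 2) ^ 2 ≤ (∑ x, π x * (u x * v x)) ^ 2 :=
      pow_le_pow_left₀ (by positivity) ih 2
    have h3 := h2.trans hcs
    have h4 : (r ^ (2 ^ j) * ∑ x, π x * u x ^ 2) ^ 2
        = (∑ x, π x * u x ^ 2) * (r ^ (2 ^ (j + 1)) * ∑ x, π x * u x ^ 2) := by
      rw [pow_succ 2 j, pow_mul r]; ring
    rw [h4] at h3
    exact le_of_mul_le_mul_left h3 hpos

lemma dirichlet_eq (h : IsReversibleChain P π) (u : Ω → ℝ) :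
    ∑ x, ∑ y, π x * P x y * (u x - u y) ^ 2
      = 2 * (∑ x, π x * u x ^ 2) - 2 * ∑ x, π x * (u x * (P.mulVec u) x) := by
  have e1 : ∑ x, ∑ y, π x * P x y * u x ^ 2 = ∑ x, π x * u x ^ 2 := by
    refine Finset.sum_congr rfl fun x _ => ?_
    rw [← Finset.sum_mul, ← Finset.mul_sum, h.row_sum, mul_one]
  have e2 : ∑ x, ∑ y, π x * P x y * u y ^ 2 = ∑ x, π x * u x ^ 2 := by
    rw [Finset.sum_comm, ← e1]
    exact Finset.sum_congr rfl fun x _ => Finset.sum_congr rfl fun y _ => by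
      rw [h.detailed_balance]
  have e3 : ∑ x, ∑ y, π x * P x y * (u x * u y) = ∑ x, π x * (u x * (P.mulVec u) x) := by
    refine Finset.sum_congr rfl fun x _ => ?_
    simp only [Matrix.mulVec, dotProduct, Finset.mul_sum]
    exact Finset.sum_congr rfl fun y _ => by ring
  rw [← e3, two_mul]
  nth_rw 2 [← e2]
  rw [← e1]
  simp only [Finset.mul_sum, ← Finset.sum_add_distrib, ← Finset.sum_sub_distrib]
  exact Finset.sum_congr rfl fun x _ => Finset.sum_congr rfl fun y _ => by ring

/-- The relaxation time bounds the mixing time from below: a positive time at which the chain is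
close to equilibrium is at least the variance of any function divided by its Dirichlet form. -/
theorem variance_le_mul_time (h : IsReversibleChain P π) (f : Ω → ℝ) {D : ℝ}
    (hD : ∑ x, ∑ y, π x * P x y * (f x - f y) ^ 2 ≤ D) {t : ℕ} (ht0 : 1 ≤ t)
    (ht : ∀ ξ, tvDist ((P ^ t) ξ) π ≤ 1 / (2 * Real.exp 1)) :
    ∑ x, π x * (f x - ∑ y, π y * f y) ^ 2 ≤ D * t := by
  set a := ∑ y, π y * f y with ha
  set u : Ω → ℝ := fun x => f x - a with hu
  set V := ∑ x, π x * u x ^ 2 with hV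
  have ht1 : (1 : ℝ) ≤ t := by exact_mod_cast ht0
  have hmean : ∑ x, π x * u x = 0 := by
    simp only [hu, mul_sub, Finset.sum_sub_distrib, ← Finset.sum_mul, h.pi_sum, ← ha]; ring
  have hDu : 2 * V - 2 * ∑ x, π x * (u x * (P.mulVec u) x) ≤ D := by
    rw [← h.dirichlet_eq]
    simpa [hu] using hD
  by_contra! hlt
  change D * t < V at hlt
  have hD0 : 0 ≤ D := le_trans (Finset.sum_nonneg fun x _ => Finset.sum_nonneg fun y _ =>
    mul_nonneg (mul_nonneg (h.pi_nonneg x) (h.nonneg x y)) (sq_nonneg _)) hD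
  have hVpos : 0 < V := lt_of_le_of_lt (by positivity) hlt
  obtain ⟨K, hK⟩ : ∃ K : ℝ, ∀ x, |u x| ≤ K :=
    ⟨∑ x, |u x|, fun x => Finset.single_le_sum (f := fun x => |u x|)
      (fun _ _ => abs_nonneg _) (Finset.mem_univ x)⟩
  have hne : Nonempty Ω := by
    by_contra hne
    rw [not_nonempty_iff] at hne
    simpa using h.pi_sum
  have hK0 : 0 ≤ K := (abs_nonneg _).trans (hK hne.some)
  -- This r bounds the Rayleigh quotient of u from below. If D * t < V it exceeds 1 - 1 / (2 * t) ≥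
  -- exp (-1 / t), faster than the decay rate that mixing at time t imposes; t ≥ 1 also makes r
  -- nonnegative.
  set r : ℝ := 1 - D / (2 * V) with hr
  have hgam : D / (2 * V) < 1 / (2 * t) := by
    rw [div_lt_div_iff₀ (by positivity) (by positivity)]
    nlinarith
  have hr1 : 1 - 1 / (2 * (t : ℝ)) < r := by linarith
  have hhalf : 1 / (2 * (t : ℝ)) ≤ 1 / 2 := by
    apply one_div_le_one_div_of_le <;> linarith
  have hr0 : 0 ≤ r := by linarith
  have hrV : r * V ≤ ∑ x, π x * (u x * (P.mulVec u) x) := by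
    have : r * V = V - D / 2 := by rw [hr]; field_simp
    linarith
  have hexp : Real.exp (-(1 / (t : ℝ))) < r := by
    refine lt_of_le_of_lt ?_ hr1
    have hx0 : 0 < 1 / (t : ℝ) := by positivity
    have hx1 : 1 / (t : ℝ) ≤ 1 := by rw [div_le_one (by linarith)]; exact ht1
    have e : 1 / (2 * (t : ℝ)) = 1 / t / 2 := by field_simp
    rw [e]
    set y := 1 / (t : ℝ)
    rw [Real.exp_neg, inv_le_comm₀ (Real.exp_pos _) (by linarith)]
    have h2 := Real.add_one_le_exp y
    refine le_trans ?_ h2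
    rw [inv_le_iff_one_le_mul₀ (by linarith)]
    nlinarith
  have hbound : ∀ j : ℕ, r ^ (2 ^ j) * V
      ≤ K ^ 2 * Real.exp 1 * Real.exp (-(1 / (t : ℝ))) ^ (2 ^ j) := by
    intro j
    refine (h.pow_two_pow_le u hr0 hrV j).trans ?_
    set N := 2 ^ j with hN
    have hsup : ∀ x, |((P ^ N).mulVec u) x| ≤ Real.exp (-1) ^ (N / t) * K := by
      intro x
      have e : P ^ N = P ^ (t * (N / t)) * P ^ (N % t) := by
        rw [← pow_add, Nat.div_add_mod]
      rw [e, ← Matrix.mulVec_mulVec]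
      have := h.abs_pow_mul_mulVec_le (by positivity) ht
        (h.abs_pow_mulVec_le (N % t) hK) hK0 (by rw [h.mean_pow_mulVec, hmean]) (N / t) x
      have e2 : 2 * (1 / (2 * Real.exp 1)) = Real.exp (-1) := by
        rw [Real.exp_neg]; field_simp
      rwa [e2] at this
    -- Rounding `N / t` down costs one factor e.
    have hle : Real.exp (-1) ^ (N / t)
        ≤ Real.exp 1 * Real.exp (-(1 / (t : ℝ))) ^ N := by
      rw [← Real.exp_nat_mul, ← Real.exp_nat_mul, ← Real.exp_add]
      apply Real.exp_le_exp.2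
      have h1 : (N : ℝ) < t * ((N / t : ℕ) + 1 : ℝ) := by
        exact_mod_cast Nat.lt_mul_div_succ N (by omega)
      have h2 : (N : ℝ) * (1 / t) ≤ (N / t : ℕ) + 1 := by
        rw [mul_one_div, div_le_iff₀ (by linarith)]; linarith
      linarith
    calc ∑ x, π x * (u x * ((P ^ N).mulVec u) x)
        ≤ ∑ x, π x * (K * (Real.exp (-1) ^ (N / t) * K)) := by
          refine Finset.sum_le_sum fun x _ => mul_le_mul_of_nonneg_left ?_ (h.pi_nonneg x)
          refine (le_abs_self _).trans ?_
          rw [abs_mul]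
          exact mul_le_mul (hK x) (hsup x) (abs_nonneg _) hK0
      _ = K ^ 2 * Real.exp (-1) ^ (N / t) := by
          rw [← Finset.sum_mul, h.pi_sum]; ring
      _ ≤ K ^ 2 * (Real.exp 1 * Real.exp (-(1 / (t : ℝ))) ^ N) := by gcongr
      _ = _ := by ring
  set e := Real.exp (-(1 / (t : ℝ))) with he
  have he0 : 0 < e := Real.exp_pos _
  have hq : 1 < r / e := by rwa [one_lt_div he0]
  have hq2 : ∀ j : ℕ, (r / e) ^ (2 ^ j) ≤ K ^ 2 * Real.exp 1 / V := by
    intro j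
    rw [div_pow, div_le_div_iff₀ (by positivity) hVpos]
    exact hbound j
  obtain ⟨k, hk⟩ := pow_unbounded_of_one_lt (K ^ 2 * Real.exp 1 / V) hq
  have := hq2 k
  have h3 : (r / e) ^ k ≤ (r / e) ^ (2 ^ k) :=
    pow_le_pow_right₀ hq.le (Nat.lt_two_pow_self).le
  linarith

/-- At time `0` the chain is far from equilibrium as soon as there are two states. -/
lemma not_mixed_zero [Nontrivial Ω] (h : IsReversibleChain P π)
    (ht : ∀ ξ, tvDist ((P ^ 0) ξ) π ≤ 1 / (2 * Real.exp 1)) : False := by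
  have key : ∀ ξ, 1 / 2 < π ξ := by
    intro ξ
    have h1 : 1 - π ξ ≤ |(P ^ 0) ξ ξ - π ξ| := by
      simpa using le_abs_self (1 - π ξ)
    have h2 : ∑ x ∈ Finset.univ.erase ξ, |(P ^ 0) ξ x - π x| = 1 - π ξ := by
      rw [← h.pi_sum, ← Finset.add_sum_erase _ _ (Finset.mem_univ ξ), add_sub_cancel_left]
      refine Finset.sum_congr rfl fun x hx => ?_
      rw [pow_zero, Matrix.one_apply_ne (Finset.ne_of_mem_erase hx).symm, zero_sub, abs_neg,
        abs_of_nonneg (h.pi_nonneg x)]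
    have h3 := ht ξ
    rw [tvDist, ← Finset.add_sum_erase _ _ (Finset.mem_univ ξ), h2] at h3
    have h4 : 1 / (2 * Real.exp 1) < 1 / 2 := by
      apply one_div_lt_one_div_of_lt (by norm_num)
      have := Real.add_one_lt_exp (one_ne_zero)
      linarith
    linarith
  obtain ⟨x, y, hxy⟩ := exists_pair_ne Ω
  have : π x + π y ≤ 1 := by
    rw [← h.pi_sum, ← Finset.sum_pair hxy]
    exact Finset.sum_le_sum_of_subset_of_nonneg (Finset.subset_univ _) fun z _ _ => h.pi_nonneg z
  linarith [key x, key y]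

end IsReversibleChain

end Mixing

/-! ### Reversibility of the two dynamics and the Dirichlet forms of the total height -/

section Dynamics

variable {n : ℕ}

lemma height_succ (η : Config n) (i : Fin n) : height η (i.val + 1) = (η i).val := by
  simp only [height]
  rw [dif_pos ⟨by omega, by omega⟩]
  rfl

lemma height_update (η : Config n) (i : Fin n) (j : Fin (n + 1)) (k : ℕ) :
    height (Function.update η i j) k = if k = i.val + 1 then (j.val : ℤ) else height η k := by
  split_ifs with h
  · subst h; rw [height_succ, Function.update_self]
  · unfold height
    split_ifs with h2
    · rw [Function.update_of_ne]
      intro h3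
      have := congrArg Fin.val h3
      simp only at this
      omega
    · rfl

/-- Only the two edges at position i + 1 involve the updated height. -/
lemma energy_update_sub (η : Config n) (i : Fin n) (j : Fin (n + 1)) :
    energy (Function.update η i j) - energy η
      = (|height η i.val - j.val| + |(j.val : ℤ) - height η (i.val + 2)|)
        - (|height η i.val - (η i).val| + |((η i).val : ℤ) - height η (i.val + 2)|) := by
  unfold energy
  rw [← Finset.sum_sub_distrib,
    ← Finset.sum_subset (s₁ := {i.val + 1, i.val + 2})]
  · rw [Finset.sum_pair (by omega)]
    simp only [height_update, height_succ, Nat.add_sub_cancel]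
    have e : i.val + 2 - 1 = i.val + 1 := by omega
    have e1 : i.val ≠ i.val + 1 := by omega
    have e2 : i.val + 2 ≠ i.val + 1 := by omega
    simp only [e, e1, e2, if_true, if_false, height_succ, Function.update_self]
    ring
  · intro k hk
    have := i.isLt
    simp only [Finset.mem_insert, Finset.mem_singleton] at hk
    rw [Finset.mem_Icc]; omega
  · intro k hk hk2
    simp only [Finset.mem_insert, Finset.mem_singleton, not_or, Finset.mem_Icc] at hk hk2
    rw [height_update, height_update, if_neg (by omega), if_neg (by omega)]
    ring

lemma weight_pos (β : ℝ) (η : Config n) : 0 < weight β η := Real.exp_pos _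

lemma partitionFunction_pos (β : ℝ) (n : ℕ) : 0 < partitionFunction β n :=
  Finset.sum_pos (fun η _ => weight_pos β η) Finset.univ_nonempty

lemma gibbs_pos (β : ℝ) (η : Config n) : 0 < gibbs β n η :=
  div_pos (weight_pos β η) (partitionFunction_pos β n)

lemma sum_gibbs (β : ℝ) (n : ℕ) : ∑ η, gibbs β n η = 1 := by
  simp only [gibbs, ← Finset.sum_div]
  exact div_self (partitionFunction_pos β n).ne'

/-- The total height of a configuration. -/
def totalHeight (η : Config n) : ℝ := ∑ i, ((η i).val : ℝ)

lemma totalHeight_update (η : Config n) (i : Fin n) (j : Fin (n + 1)) :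
    totalHeight η - totalHeight (Function.update η i j) = ((η i).val : ℝ) - (j.val : ℝ) := by
  unfold totalHeight
  rw [← Finset.sum_sub_distrib, Finset.sum_eq_single i]
  · simp
  · intro k _ hk; simp [Function.update_of_ne hk]
  · simp

/-- Conditionally on the choice of the position `i`, the single-site transition matrix. -/
noncomputable def siteKernel (β : ℝ) (i : Fin n) (η η' : Config n) : ℝ :=
  (if η' = lower η i then probDown β η i else 0)
    + (if η' = raise η i then probUp β η i else 0)
    + (if η' = η then 1 - (probDown β η i + probUp β η i) else 0)

lemma singleSite_apply (β : ℝ) (η η' : Config n) :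
    singleSite β n η η' = (1 / (n : ℝ)) * ∑ i, siteKernel β i η η' := rfl

/-- Conditionally on the choice of the position `i`, the column transition matrix. -/
noncomputable def columnKernel (β : ℝ) (i : Fin n) (η η' : Config n) : ℝ :=
  ∑ j : Fin (n + 1),
    if η' = Function.update η i j then
      gibbs β n (Function.update η i j) / ∑ k : Fin (n + 1), gibbs β n (Function.update η i k)
    else 0

lemma column_apply (β : ℝ) (η η' : Config n) :
    column β n η η' = (1 / (n : ℝ)) * ∑ i, columnKernel β i η η' := rfl

lemma probDown_mem (β : ℝ) (hβ : 0 < β) (η : Config n) (i : Fin n) :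
    0 ≤ probDown β η i ∧ probDown β η i ≤ 1 / 4 := by
  have h1 : Real.exp (-2 * β) ≤ 1 := Real.exp_le_one_iff.2 (by linarith)
  have h2 := Real.exp_pos (-2 * β)
  unfold probDown
  split_ifs <;> constructor <;> linarith

lemma probUp_mem (β : ℝ) (hβ : 0 < β) (η : Config n) (i : Fin n) :
    0 ≤ probUp β η i ∧ probUp β η i ≤ 1 / 4 := by
  have h1 : Real.exp (-2 * β) ≤ 1 := Real.exp_le_one_iff.2 (by linarith)
  have h2 := Real.exp_pos (-2 * β)
  unfold probUp
  split_ifs <;> constructor <;> linarith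

/-- Lowering changes the energy by 2 when the height is at most both neighbours, by -2 when it
exceeds both, and by 0 otherwise. In the first case the factor exp (-2 * β) sits on the down move,
in the second on the reverse up move, and in the third on neither. -/
lemma weight_mul_probDown (β : ℝ) (η : Config n) (i : Fin n) (h : 1 ≤ (η i).val) :
    weight β η * probDown β η i = weight β (lower η i) * probUp β (lower η i) i := by
  have hE := energy_update_sub η i ⟨(η i).val - 1, by omega⟩
  change energy (lower η i) - _ = _ at hE
  have hv : ((lower η i) i).val = (η i).val - 1 := by simp [lower]
  have hh : highNbr (lower η i) i = highNbr η i := by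
    unfold highNbr lower
    rw [height_update, height_update, if_neg (by omega), if_neg (by omega)]
  have hc : (((η i).val - 1 : ℕ) : ℤ) = (η i).val - 1 := by omega
  simp only [hc] at hE
  unfold probDown probUp
  rw [hh, hv, hc]
  unfold lowNbr highNbr
  unfold weight
  generalize energy (lower η i) = E' at *
  generalize energy η = E at *
  generalize ((η i).val : ℤ) = x at *
  generalize height η i.val = p at *
  generalize height η (i.val + 2) = q at *
  have key : ∀ d : ℤ, E' - E = d → Real.exp (-β * (E' : ℝ)) = Real.exp (-β * E) * Real.exp (-β * d) := by
    intro d hd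
    rw [← Real.exp_add, ← hd]; congr 1; push_cast; ring
  by_cases h1 : x ≤ min p q
  · have h2 : ¬ (max p q ≤ x - 1) := by omega
    rw [if_pos h1, if_neg h2, key 2 (by rw [hE]; grind)]
    push_cast
    rw [show -β * 2 = -2 * β by ring]; ring
  · by_cases h2 : max p q ≤ x - 1
    · rw [if_neg h1, if_pos h2, key (-2) (by rw [hE]; grind)]
      have : Real.exp (-β * ((-2 : ℤ) : ℝ)) * Real.exp (-2 * β) = 1 := by
        rw [← Real.exp_add, ← Real.exp_zero]; congr 1; push_cast; ring
      linear_combination (-(1 / 4) * Real.exp (-β * E)) * this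
    · rw [if_neg h1, if_neg h2, key 0 (by rw [hE]; grind)]
      simp

/-- Between distinct configurations no truncation at 0 or n takes place, so lowering and raising are
inverse to each other. -/
lemma siteKernel_aux (β : ℝ) (i : Fin n) {η η' : Config n} (hne : η ≠ η') :
    weight β η * (if η' = lower η i then probDown β η i else 0)
      = weight β η' * (if η = raise η' i then probUp β η' i else 0) := by
  by_cases h : η' = lower η i
  · have hx : 1 ≤ (η i).val := by
      by_contra hx
      apply hne
      rw [h]
      funext k
      by_cases hk : k = i
      · subst hk; apply Fin.ext; simp [lower]; omega
      · simp [lower, Function.update_of_ne hk]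
    have h2 : η = raise η' i := by
      have := (η i).isLt
      rw [h]
      funext k
      by_cases hk : k = i
      · subst hk; apply Fin.ext; simp [lower, raise]; omega
      · simp [lower, raise, Function.update_of_ne hk]
    rw [if_pos h, if_pos h2, weight_mul_probDown β η i hx, ← h]
  · rw [if_neg h, if_neg, mul_zero, mul_zero]
    intro h2
    apply h
    have hx : (η' i).val + 1 ≤ n := by
      by_contra hx
      apply hne
      rw [h2]
      have := (η' i).isLt
      funext k
      by_cases hk : k = i
      · subst hk; apply Fin.ext; simp [raise]; omega
      · simp [raise, Function.update_of_ne hk]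
    rw [h2]
    funext k
    by_cases hk : k = i
    · subst hk; apply Fin.ext; simp [lower, raise]; omega
    · simp [lower, raise, Function.update_of_ne hk]

lemma siteKernel_symm (β : ℝ) (i : Fin n) (η η' : Config n) :
    gibbs β n η * siteKernel β i η η' = gibbs β n η' * siteKernel β i η' η := by
  by_cases hne : η = η'
  · rw [hne]
  · have h1 := siteKernel_aux β i hne
    have h2 := siteKernel_aux β i (Ne.symm hne)
    have : weight β η * siteKernel β i η η' = weight β η' * siteKernel β i η' η := by
      unfold siteKernel
      rw [if_neg hne, if_neg (Ne.symm hne)]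
      linear_combination h1 - h2
    unfold gibbs
    rw [div_mul_eq_mul_div, div_mul_eq_mul_div, this]

lemma columnKernel_eq (β : ℝ) (i : Fin n) (η η' : Config n) :
    columnKernel β i η η' = if η' = Function.update η i (η' i) then
      gibbs β n η' / ∑ k : Fin (n + 1), gibbs β n (Function.update η i k) else 0 := by
  unfold columnKernel
  rw [Finset.sum_eq_single (η' i)]
  · split_ifs with h
    · rw [← h]
    · rfl
  · intro j _ hj
    rw [if_neg]
    intro h
    apply hj
    rw [h, Function.update_self]
  · simp

/-- The normalizing sum runs over all heights at i, hence is the same for two configurations that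
differ only there. -/
lemma columnKernel_symm (β : ℝ) (i : Fin n) (η η' : Config n) :
    gibbs β n η * columnKernel β i η η' = gibbs β n η' * columnKernel β i η' η := by
  rw [columnKernel_eq, columnKernel_eq]
  by_cases h : η' = Function.update η i (η' i)
  · have h2 : η = Function.update η' i (η i) := by
      rw [h]; simp
    rw [if_pos h, if_pos h2]
    have h3 : ∀ k, Function.update η' i k = Function.update η i k := by
      intro k; rw [h]; simp
    simp only [h3]
    ring
  · have h2 : ¬ η = Function.update η' i (η i) := by
      intro h2; apply h; rw [h2]; simp
    rw [if_neg h, if_neg h2, mul_zero, mul_zero]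

lemma sum_siteKernel_mul (β : ℝ) (i : Fin n) (η : Config n) (g : Config n → ℝ) :
    ∑ η', siteKernel β i η η' * g η'
      = probDown β η i * g (lower η i) + probUp β η i * g (raise η i)
        + (1 - (probDown β η i + probUp β η i)) * g η := by
  simp [siteKernel, add_mul, Finset.sum_add_distrib, ite_mul]

lemma columnKernel_sum (β : ℝ) (i : Fin n) (η : Config n) :
    ∑ η', columnKernel β i η η' = 1 := by
  unfold columnKernel
  rw [Finset.sum_comm]
  simp only [Finset.sum_ite_eq', Finset.mem_univ, if_true]
  rw [← Finset.sum_div, div_self]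
  exact (Finset.sum_pos (fun _ _ => gibbs_pos β _) Finset.univ_nonempty).ne'

lemma columnKernel_nonneg (β : ℝ) (i : Fin n) (η η' : Config n) : 0 ≤ columnKernel β i η η' :=
  Finset.sum_nonneg fun j _ => by
    split_ifs
    · exact div_nonneg (gibbs_pos β _).le (Finset.sum_nonneg fun _ _ => (gibbs_pos β _).le)
    · exact le_rfl

lemma isReversibleChain_of_kernels {Ω : Type*} [Fintype Ω] [DecidableEq Ω]
    (hn : 1 ≤ n) {π : Ω → ℝ} {P : Matrix Ω Ω ℝ} {K : Fin n → Ω → Ω → ℝ}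
    (hP : ∀ x y, P x y = (1 / (n : ℝ)) * ∑ i, K i x y)
    (h0 : ∀ i x y, 0 ≤ K i x y) (h1 : ∀ i x, ∑ y, K i x y = 1)
    (hsymm : ∀ i x y, π x * K i x y = π y * K i y x) (hπ : ∀ x, 0 ≤ π x) (hπ1 : ∑ x, π x = 1) :
    IsReversibleChain P π where
  nonneg x y := by
    rw [hP]; exact mul_nonneg (by positivity) (Finset.sum_nonneg fun i _ => h0 i x y)
  row_sum x := by
    simp only [hP, ← Finset.mul_sum]
    rw [Finset.sum_comm]
    simp only [h1, Finset.sum_const, Finset.card_univ, Fintype.card_fin, nsmul_eq_mul, mul_one]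
    have : (n : ℝ) ≠ 0 := by positivity
    field_simp
  pi_nonneg := hπ
  pi_sum := hπ1
  detailed_balance x y := by
    rw [hP, hP, mul_left_comm, mul_left_comm (π y), Finset.mul_sum (a := π x),
      Finset.mul_sum (a := π y)]
    exact congrArg _ (Finset.sum_congr rfl fun i _ => hsymm i x y)

lemma singleSite_isReversibleChain (β : ℝ) (hβ : 0 < β) (hn : 1 ≤ n) :
    IsReversibleChain (singleSite β n) (gibbs β n) := by
  refine isReversibleChain_of_kernels hn (singleSite_apply β) ?_ ?_ (siteKernel_symm β)
    (fun η => (gibbs_pos β η).le) (sum_gibbs β n)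
  · intro i η η'
    have h1 := probDown_mem β hβ η i
    have h2 := probUp_mem β hβ η i
    unfold siteKernel
    have h3 : (0 : ℝ) ≤ 1 - (probDown β η i + probUp β η i) := by linarith
    refine add_nonneg (add_nonneg ?_ ?_) ?_
    · split_ifs
      exacts [h1.1, le_rfl]
    · split_ifs
      exacts [h2.1, le_rfl]
    · split_ifs
      exacts [h3, le_rfl]
  · intro i η
    have := sum_siteKernel_mul β i η (fun _ => 1)
    simp only [mul_one] at this
    rw [this]; ring

lemma column_isReversibleChain (β : ℝ) (hn : 1 ≤ n) :
    IsReversibleChain (column β n) (gibbs β n) :=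
  isReversibleChain_of_kernels hn (column_apply β) (columnKernel_nonneg β)
    (columnKernel_sum β) (columnKernel_symm β) (fun η => (gibbs_pos β η).le) (sum_gibbs β n)

lemma dirichlet_of_kernels {Ω : Type*} [Fintype Ω] [DecidableEq Ω]
    (hn : 1 ≤ n) {π : Ω → ℝ} {P : Matrix Ω Ω ℝ} {K : Fin n → Ω → Ω → ℝ}
    (hP : ∀ x y, P x y = (1 / (n : ℝ)) * ∑ i, K i x y) (f : Ω → ℝ) {C : ℝ}
    (hC : ∑ i, ∑ x, π x * ∑ y, K i x y * (f x - f y) ^ 2 ≤ n * C) :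
    ∑ x, ∑ y, π x * P x y * (f x - f y) ^ 2 ≤ C := by
  have hn0 : (0 : ℝ) < n := by positivity
  have : ∑ x, ∑ y, π x * P x y * (f x - f y) ^ 2
      = (1 / (n : ℝ)) * ∑ i, ∑ x, π x * ∑ y, K i x y * (f x - f y) ^ 2 := by
    rw [Finset.sum_comm (γ := Fin n)]
    simp only [hP, Finset.mul_sum, Finset.sum_mul]
    refine Finset.sum_congr rfl fun x _ => ?_
    rw [Finset.sum_comm]
    exact Finset.sum_congr rfl fun y _ => Finset.sum_congr rfl fun i _ => by ring
  rw [this, one_div, inv_mul_le_iff₀ hn0]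
  exact hC

lemma singleSite_dirichlet_le (β : ℝ) (hβ : 0 < β) (hn : 1 ≤ n) :
    ∑ x, ∑ y, gibbs β n x * singleSite β n x y * (totalHeight x - totalHeight y) ^ 2 ≤ 1 := by
  refine dirichlet_of_kernels hn (singleSite_apply β) _ ?_
  have key : ∀ i : Fin n, ∑ x, gibbs β n x * ∑ y, siteKernel β i x y *
      (totalHeight x - totalHeight y) ^ 2 ≤ 1 := by
    intro i
    rw [← sum_gibbs β n]
    refine Finset.sum_le_sum fun η _ => ?_
    have h : ∑ y, siteKernel β i η y * (totalHeight η - totalHeight y) ^ 2 ≤ 1 := by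
      rw [sum_siteKernel_mul β i η fun y => (totalHeight η - totalHeight y) ^ 2]
      have h1 := probDown_mem β hβ η i
      have h2 := probUp_mem β hβ η i
      have e1 : (totalHeight η - totalHeight (lower η i)) ^ 2 ≤ 1 := by
        rw [lower, totalHeight_update]
        simp only
        rcases Nat.eq_zero_or_pos (η i).val with h | h
        · rw [h]; norm_num
        · rw [Nat.cast_sub h]; norm_num
      have e2 : (totalHeight η - totalHeight (raise η i)) ^ 2 ≤ 1 := by
        rw [raise, totalHeight_update]
        simp only
        rcases Nat.lt_or_ge (η i).val n with h | h
        · rw [min_eq_left (by omega)]; push_cast; norm_num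
        · have : (η i).val = n := by omega
          rw [min_eq_right (by omega), this]; norm_num
      rw [sub_self]
      nlinarith [sq_nonneg (totalHeight η - totalHeight (lower η i)),
        sq_nonneg (totalHeight η - totalHeight (raise η i))]
    exact mul_le_of_le_one_right (gibbs_pos β η).le h
  calc _ ≤ ∑ _i : Fin n, (1 : ℝ) := Finset.sum_le_sum fun i _ => key i
    _ = _ := by simp

/-- Resampling at i leaves the left neighbour fixed, so the change of the total height is the change
of the difference to that neighbour. Its square is at most twice the sum of the squares before and
after, and by reversibility these have equal mean. -/
lemma column_dirichlet_le (β : ℝ) (hn : 1 ≤ n) {C : ℝ}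
    (hC : ∑ η : Config n, gibbs β n η *
      ∑ i : Fin n, (((η i).val : ℝ) - (height η i.val : ℝ)) ^ 2 ≤ n * C) :
    ∑ x, ∑ y, gibbs β n x * column β n x y * (totalHeight x - totalHeight y) ^ 2 ≤ 4 * C := by
  refine dirichlet_of_kernels hn (column_apply β) _ ?_
  -- The index i stands for the position i + 1, so `height η i.val` is the left neighbour.
  set g : Fin n → Config n → ℝ := fun i η => ((η i).val : ℝ) - (height η i.val : ℝ) with hg
  have hdiff : ∀ i x y, columnKernel β i x y ≠ 0 → totalHeight x - totalHeight y = g i x - g i y := by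
    intro i x y hxy
    rw [columnKernel_eq] at hxy
    have h : y = Function.update x i (y i) := by
      by_contra h; rw [if_neg h] at hxy; exact hxy rfl
    have h2 : height y i.val = height x i.val := by
      rw [h, height_update, if_neg (by omega)]
    simp only [hg, h2]
    rw [h, totalHeight_update]
    simp
  have hle : ∀ i, ∑ x, gibbs β n x * ∑ y, columnKernel β i x y *
      (totalHeight x - totalHeight y) ^ 2 ≤ 4 * ∑ x, gibbs β n x * g i x ^ 2 := by
    intro i
    have s1 : ∑ x, ∑ y, gibbs β n x * columnKernel β i x y * (2 * g i x ^ 2)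
        = 2 * ∑ x, gibbs β n x * g i x ^ 2 := by
      rw [Finset.mul_sum]
      refine Finset.sum_congr rfl fun x _ => ?_
      rw [← Finset.sum_mul, ← Finset.mul_sum, columnKernel_sum]; ring
    have s2 : ∑ x, ∑ y, gibbs β n x * columnKernel β i x y * (2 * g i y ^ 2)
        = 2 * ∑ x, gibbs β n x * g i x ^ 2 := by
      rw [Finset.sum_comm, ← s1]
      exact Finset.sum_congr rfl fun x _ => Finset.sum_congr rfl fun y _ => by
        rw [columnKernel_symm]
    calc _ ≤ ∑ x, ∑ y, (gibbs β n x * columnKernel β i x y * (2 * g i x ^ 2)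
          + gibbs β n x * columnKernel β i x y * (2 * g i y ^ 2)) := by
          refine Finset.sum_le_sum fun x _ => ?_
          rw [Finset.mul_sum]
          refine Finset.sum_le_sum fun y _ => ?_
          by_cases h0 : columnKernel β i x y = 0
          · simp [h0]
          · rw [hdiff i x y h0, ← mul_add, ← mul_assoc]
            refine mul_le_mul_of_nonneg_left ?_
              (mul_nonneg (gibbs_pos β x).le (columnKernel_nonneg β i x y))
            nlinarith [sq_nonneg (g i x + g i y)]
      _ = _ := by
          simp only [Finset.sum_add_distrib]
          rw [s1, s2]; ring
  calc _ ≤ ∑ i, 4 * ∑ x, gibbs β n x * g i x ^ 2 := Finset.sum_le_sum fun i _ => hle i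
    _ = 4 * ∑ η : Config n, gibbs β n η *
      ∑ i : Fin n, (((η i).val : ℝ) - (height η i.val : ℝ)) ^ 2 := by
        rw [← Finset.mul_sum, Finset.sum_comm]
        simp only [Finset.mul_sum, hg]
    _ ≤ _ := by linarith

end Dynamics

/-! ### Loops, re-rooting and the cyclic lemma -/

section Loops

variable {n : ℕ}

/-- A closed height profile, on a cycle of `n + 1` positions. -/
abbrev Loop (n : ℕ) : Type := Fin (n + 1) → ℤ

/-- The height difference along the edge from `i` to `i + 1`. -/
def step (σ : Loop n) (i : Fin (n + 1)) : ℤ := σ (i + 1) - σ i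

/-- The energy of a loop. -/
def loopEnergy (σ : Loop n) : ℤ := ∑ i, |step σ i|

/-- The Gibbs weight of a loop. -/
noncomputable def loopWeight (β : ℝ) (σ : Loop n) : ℝ := Real.exp (-β * (loopEnergy σ : ℝ))

/-- The positions of minimal height. -/
def minSet (σ : Loop n) : Finset (Fin (n + 1)) := Finset.univ.filter fun i => ∀ j, σ i ≤ σ j

/-- The minimal height. -/
noncomputable def minVal (σ : Loop n) : ℤ := Finset.univ.inf' Finset.univ_nonempty σ

/-- The area between a loop and its minimal height. -/
noncomputable def area (σ : Loop n) : ℤ := ∑ i, σ i - (n + 1) * minVal σ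

/-- The sum of the squared height differences. -/
def sqSteps (σ : Loop n) : ℤ := ∑ i, step σ i ^ 2

/-- The loops rooted at height `0` whose heights differ by at most `K`. -/
noncomputable def loops (n K : ℕ) : Finset (Loop n) :=
  (Fintype.piFinset fun _ => Finset.Icc (-(K : ℤ)) K).filter
    fun σ => σ 0 = 0 ∧ ∀ i j, σ i - σ j ≤ K

/-- The box in the definition only serves finiteness; it follows from the other two conditions. -/
lemma mem_loops {K : ℕ} {σ : Loop n} : σ ∈ loops n K ↔ σ 0 = 0 ∧ ∀ i j, σ i - σ j ≤ K := by
  unfold loops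
  rw [Finset.mem_filter, Fintype.mem_piFinset, and_iff_right_iff_imp]
  rintro ⟨h0, h⟩ i
  have h1 := h i 0
  have h2 := h 0 i
  rw [Finset.mem_Icc]
  omega

/-- The loop re-rooted at the position `c`. -/
def rot (c : Fin (n + 1)) (σ : Loop n) : Loop n := fun i => σ (i + c) - σ c

lemma mem_minSet {σ : Loop n} {i : Fin (n + 1)} : i ∈ minSet σ ↔ ∀ j, σ i ≤ σ j := by
  simp [minSet]

lemma minSet_nonempty (σ : Loop n) : (minSet σ).Nonempty := by
  obtain ⟨i, -, hi⟩ := Finset.exists_min_image Finset.univ σ Finset.univ_nonempty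
  exact ⟨i, mem_minSet.2 fun j => hi j (Finset.mem_univ j)⟩

lemma minVal_le (σ : Loop n) (i : Fin (n + 1)) : minVal σ ≤ σ i :=
  Finset.inf'_le _ (Finset.mem_univ i)

lemma le_minVal {σ : Loop n} {a : ℤ} (h : ∀ i, a ≤ σ i) : a ≤ minVal σ :=
  Finset.le_inf' _ _ fun i _ => h i

lemma minVal_eq {σ : Loop n} {i : Fin (n + 1)} (h : i ∈ minSet σ) : minVal σ = σ i :=
  le_antisymm (minVal_le σ i) (le_minVal (mem_minSet.1 h))

lemma loopWeight_pos (β : ℝ) (σ : Loop n) : 0 < loopWeight β σ := Real.exp_pos _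

lemma step_rot (c : Fin (n + 1)) (σ : Loop n) (i : Fin (n + 1)) :
    step (rot c σ) i = step σ (i + c) := by
  simp only [step, rot, add_right_comm i 1 c]
  ring

lemma sum_step_rot {M : Type*} [AddCommMonoid M] (g : ℤ → M) (c : Fin (n + 1)) (σ : Loop n) :
    ∑ i, g (step (rot c σ) i) = ∑ i, g (step σ i) := by
  simp only [step_rot]
  exact Equiv.sum_comp (Equiv.addRight c) fun i => g (step σ i)

lemma loopWeight_rot (β : ℝ) (c : Fin (n + 1)) (σ : Loop n) :
    loopWeight β (rot c σ) = loopWeight β σ := by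
  unfold loopWeight loopEnergy
  rw [sum_step_rot]

lemma sqSteps_rot (c : Fin (n + 1)) (σ : Loop n) : sqSteps (rot c σ) = sqSteps σ :=
  sum_step_rot (· ^ 2) c σ

lemma mem_minSet_rot {c i : Fin (n + 1)} {σ : Loop n} :
    i ∈ minSet (rot c σ) ↔ i + c ∈ minSet σ := by
  simp only [mem_minSet, rot]
  constructor
  · intro h j
    have := h (j - c)
    rw [sub_add_cancel] at this
    omega
  · intro h j
    have := h (j + c)
    omega

lemma minVal_rot (c : Fin (n + 1)) (σ : Loop n) : minVal (rot c σ) = minVal σ - σ c := by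
  obtain ⟨i, hi⟩ := minSet_nonempty (rot c σ)
  rw [minVal_eq hi, minVal_eq (mem_minSet_rot.1 hi), rot]

lemma area_rot (c : Fin (n + 1)) (σ : Loop n) : area (rot c σ) = area σ := by
  unfold area
  rw [minVal_rot]
  simp only [rot, Finset.sum_sub_distrib, Finset.sum_const, Finset.card_univ, Fintype.card_fin]
  rw [show ∑ i, σ (i + c) = ∑ i, σ i from Equiv.sum_comp (Equiv.addRight c) σ]
  simp only [nsmul_eq_mul]
  push_cast
  ring

lemma card_minSet_rot (c : Fin (n + 1)) (σ : Loop n) :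
    (minSet (rot c σ)).card = (minSet σ).card :=
  Finset.card_equiv (Equiv.addRight c) fun _ => mem_minSet_rot

lemma rot_mem_loops {K : ℕ} (c : Fin (n + 1)) {σ : Loop n} (h : σ ∈ loops n K) :
    rot c σ ∈ loops n K := by
  rw [mem_loops] at h ⊢
  refine ⟨by simp [rot], fun i j => ?_⟩
  have := h.2 (i + c) (j + c)
  simp only [rot]
  omega

lemma rot_rot_neg {K : ℕ} (c : Fin (n + 1)) {σ : Loop n} (h : σ ∈ loops n K) :
    rot c (rot (-c) σ) = σ := by
  funext i
  simp [rot, (mem_loops.1 h).1]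

lemma rot_neg_rot {K : ℕ} (c : Fin (n + 1)) {σ : Loop n} (h : σ ∈ loops n K) :
    rot (-c) (rot c σ) = σ := by
  funext i
  simp [rot, (mem_loops.1 h).1]

lemma sum_mem_minSet (β : ℝ) (K : ℕ) {G : Loop n → ℝ} (hG : ∀ c σ, G (rot c σ) = G σ)
    (i : Fin (n + 1)) :
    ∑ σ ∈ (loops n K).filter (i ∈ minSet ·), loopWeight β σ * G σ
      = ∑ σ ∈ (loops n K).filter (0 ∈ minSet ·), loopWeight β σ * G σ := by
  refine Finset.sum_nbij' (rot i) (rot (-i)) ?_ ?_ ?_ ?_ ?_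
  · intro σ hσ
    rw [Finset.mem_filter] at hσ ⊢
    exact ⟨rot_mem_loops i hσ.1, mem_minSet_rot.2 (by simpa using hσ.2)⟩
  · intro σ hσ
    rw [Finset.mem_filter] at hσ ⊢
    exact ⟨rot_mem_loops _ hσ.1, mem_minSet_rot.2 (by simpa using hσ.2)⟩
  · intro σ hσ
    exact rot_neg_rot i (Finset.mem_filter.1 hσ).1
  · intro σ hσ
    exact rot_rot_neg i (Finset.mem_filter.1 hσ).1
  · intro σ _
    rw [loopWeight_rot, hG]

/-- The cyclic lemma: weighting a loop by its number of minima in `J` amounts to rooting it at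
one of them. -/
lemma sum_card_minSet_inter (β : ℝ) (K : ℕ) {G : Loop n → ℝ} (hG : ∀ c σ, G (rot c σ) = G σ)
    (J : Finset (Fin (n + 1))) :
    ∑ σ ∈ loops n K, loopWeight β σ * (G σ * ((J ∩ minSet σ).card : ℝ))
      = J.card * ∑ σ ∈ (loops n K).filter (0 ∈ minSet ·), loopWeight β σ * G σ := by
  have h : ∀ σ : Loop n, ((J ∩ minSet σ).card : ℝ) = ∑ i ∈ J, if i ∈ minSet σ then 1 else 0 := by
    intro σ
    rw [← Finset.filter_mem_eq_inter, Finset.card_filter]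
    push_cast
    rfl
  simp only [h, Finset.mul_sum]
  rw [Finset.sum_comm, ← Finset.mul_sum, ← nsmul_eq_mul, ← Finset.sum_const]
  refine Finset.sum_congr rfl fun i _ => ?_
  rw [← sum_mem_minSet β K hG i, Finset.sum_filter]
  refine Finset.sum_congr rfl fun σ _ => ?_
  split_ifs <;> simp

/-! ### Configurations as excursions, and their comparison with loops -/

/-- A configuration, closed up into a loop through the boundary. -/
def toLoop (η : Config n) : Loop n := fun i => height η i.val

lemma height_nonneg (η : Config n) (k : ℕ) : 0 ≤ height η k := by
  unfold height; split_ifs <;> omega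

lemma height_le (η : Config n) (k : ℕ) : height η k ≤ n := by
  unfold height; split_ifs with h
  · have := (η ⟨k - 1, by omega⟩).isLt
    omega
  · omega

lemma toLoop_zero (η : Config n) : toLoop η 0 = 0 := by simp [toLoop, height]

lemma toLoop_add_one (η : Config n) (i : Fin (n + 1)) :
    toLoop η (i + 1) = height η (i.val + 1) := by
  unfold toLoop
  rw [Fin.val_add_one]
  split_ifs with h
  · subst h; simp [height]
  · rfl

lemma loopEnergy_toLoop (η : Config n) : loopEnergy (toLoop η) = energy η := by
  unfold loopEnergy energy step
  have h : ∑ k ∈ Finset.Icc 1 (n + 1), |height η (k - 1) - height η k|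
      = ∑ k ∈ Finset.range (n + 1), |height η k - height η (k + 1)| := by
    rw [Finset.range_eq_Ico]
    exact (Finset.sum_Ico_add' (fun k => |height η (k - 1) - height η k|) 0 (n + 1) 1).symm
  rw [h, Finset.sum_range]
  refine Finset.sum_congr rfl fun i _ => ?_
  rw [toLoop_add_one, abs_sub_comm]
  rfl

lemma loopWeight_toLoop (β : ℝ) (η : Config n) : loopWeight β (toLoop η) = weight β η := by
  rw [loopWeight, loopEnergy_toLoop, weight]

/-- Closing up is a bijection onto the loops with a minimum at the root: such a loop is nonnegative,
and height differences of at most n keep it in {0, …, n}. -/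
lemma sum_weight_eq (β : ℝ) (G : Loop n → ℝ) :
    ∑ η : Config n, weight β η * G (toLoop η)
      = ∑ σ ∈ (loops n n).filter (0 ∈ minSet ·), loopWeight β σ * G σ := by
  refine Finset.sum_bij' (fun η _ => toLoop η)
    (fun σ hσ i => ⟨(σ i.succ).toNat, ?_⟩) ?_ ?_ ?_ ?_ ?_
  · rw [Finset.mem_filter, mem_loops] at hσ
    have := hσ.1.2 i.succ 0
    have := hσ.1.1
    omega
  · intro η _
    rw [Finset.mem_filter, mem_loops, mem_minSet, toLoop_zero]
    refine ⟨⟨rfl, fun i j => ?_⟩, fun j => height_nonneg _ _⟩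
    have := height_le η i.val
    have := height_nonneg η j.val
    simp only [toLoop]
    omega
  · intro σ _
    exact Finset.mem_univ _
  · intro η _
    funext i
    apply Fin.ext
    simp [toLoop, height_succ]
  · intro σ hσ
    rw [Finset.mem_filter, mem_loops, mem_minSet] at hσ
    funext i
    refine Fin.cases ?_ (fun i => ?_) i
    · rw [toLoop_zero, hσ.1.1]
    · have h := height_succ (fun i => ⟨(σ i.succ).toNat, by
        have := hσ.1.2 i.succ 0
        have := hσ.1.1
        omega⟩ : Config n) i
      simp only [toLoop, Fin.val_succ]
      rw [h]
      have := hσ.2 i.succ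
      have := hσ.1.1
      simp only
      omega
  · intro η _
    rw [loopWeight_toLoop]

lemma area_toLoop (η : Config n) : (area (toLoop η) : ℝ) = totalHeight η := by
  have h0 : (0 : Fin (n + 1)) ∈ minSet (toLoop η) :=
    mem_minSet.2 fun j => by rw [toLoop_zero]; exact height_nonneg _ _
  unfold area totalHeight
  rw [minVal_eq h0, toLoop_zero, Fin.sum_univ_succ, toLoop_zero]
  push_cast
  simp only [toLoop, Fin.val_succ, height_succ]
  simp

lemma sum_sq_sub_height_le (η : Config n) :
    ∑ i : Fin n, (((η i).val : ℝ) - (height η i.val : ℝ)) ^ 2 ≤ (sqSteps (toLoop η) : ℝ) := by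
  unfold sqSteps step
  rw [Fin.sum_univ_castSucc]
  push_cast
  refine le_add_of_le_of_nonneg (le_of_eq ?_) (sq_nonneg _)
  refine Finset.sum_congr rfl fun i _ => ?_
  rw [toLoop_add_one]
  simp only [toLoop, Fin.val_castSucc, height_succ]
  push_cast
  rfl

lemma loopEnergy_add_le (σ e : Loop n) :
    loopEnergy (σ + e) ≤ loopEnergy σ + ∑ i, |step e i| := by
  unfold loopEnergy
  rw [← Finset.sum_add_distrib]
  refine Finset.sum_le_sum fun i _ => ?_
  have : step (σ + e) i = step σ i + step e i := by simp only [step, Pi.add_apply]; ring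
  rw [this]
  exact abs_add_le _ _

lemma loopWeight_le_of_energy {β : ℝ} (hβ : 0 < β) {σ τ : Loop n}
    (h : loopEnergy τ ≤ loopEnergy σ + 2) :
    loopWeight β σ ≤ Real.exp (2 * β) * loopWeight β τ := by
  unfold loopWeight
  rw [← Real.exp_add]
  apply Real.exp_le_exp.2
  have : (loopEnergy τ : ℝ) ≤ loopEnergy σ + 2 := by exact_mod_cast h
  nlinarith

/-- Raising every position but the root. -/
def raiseOff (σ : Loop n) : Loop n := σ + fun i => if i = 0 then 0 else 1

lemma loopEnergy_raiseOff_le (σ : Loop n) : loopEnergy (raiseOff σ) ≤ loopEnergy σ + 2 := by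
  refine (loopEnergy_add_le _ _).trans (add_le_add_right ?_ _)
  calc _ ≤ ∑ i : Fin (n + 1), ((if i = 0 then (1 : ℤ) else 0) + if i = Fin.last n then 1 else 0) := by
        refine Finset.sum_le_sum fun i _ => ?_
        have h : i + 1 = 0 ↔ i = Fin.last n := by
          rw [← Fin.last_add_one, add_left_inj]
        simp only [step, h]
        split_ifs <;> simp
    _ = 2 := by simp [Finset.sum_add_distrib]

/-- At a minimum both adjacent edges lead upward or are level, so lifting the neighbours only
lengthens these steps. -/
lemma sqSteps_le_raiseOff {σ : Loop n} (h : 0 ∈ minSet σ) : sqSteps σ ≤ sqSteps (raiseOff σ) := by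
  refine Finset.sum_le_sum fun i _ => ?_
  rw [mem_minSet] at h
  simp only [step, raiseOff, Pi.add_apply]
  have h1 := h i
  have h2 := h (i + 1)
  by_cases hi : i = 0 <;> by_cases hj : i + 1 = 0
  · rw [if_pos hi, if_pos hj]
    exact le_of_eq (by ring)
  · rw [if_pos hi, if_neg hj]
    rw [← hi] at h2
    nlinarith
  · rw [if_neg hi, if_pos hj, hj]
    nlinarith
  · rw [if_neg hi, if_neg hj]
    exact le_of_eq (by ring)

lemma minSet_raiseOff {σ : Loop n} (h : 0 ∈ minSet σ) : minSet (raiseOff σ) = {0} := by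
  rw [mem_minSet] at h
  ext i
  rw [mem_minSet, Finset.mem_singleton]
  simp only [raiseOff, Pi.add_apply]
  constructor
  · intro hi
    by_contra h0
    have h1 := hi 0
    rw [if_neg h0, if_pos rfl] at h1
    have := h i
    omega
  · rintro rfl j
    have := h j
    rw [if_pos rfl]
    split_ifs <;> omega

/-- Lowering the root of an excursion makes it the only minimum. -/
lemma mul_sum_excursions_le {β : ℝ} (hβ : 0 < β) {G : Loop n → ℝ}
    (hG : ∀ c σ, G (rot c σ) = G σ) (hG0 : ∀ σ, 0 ≤ G σ)
    (hmono : ∀ σ, 0 ∈ minSet σ → G σ ≤ G (raiseOff σ)) :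
    (n + 1) * ∑ σ ∈ (loops n n).filter (0 ∈ minSet ·), loopWeight β σ * G σ
      ≤ Real.exp (2 * β) * ∑ σ ∈ loops n (n + 1), loopWeight β σ * G σ := by
  -- With a unique minimum the count in the cyclic lemma is one, so no factor is lost to the number
  -- of minima.
  set G' : Loop n → ℝ := fun σ => if (minSet σ).card = 1 then G σ else 0 with hG'
  have hG'rot : ∀ c σ, G' (rot c σ) = G' σ := by
    intro c σ
    simp only [hG', card_minSet_rot, hG]
  have hG'0 : ∀ σ, 0 ≤ G' σ := by
    intro σ
    simp only [hG']
    split_ifs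
    exacts [hG0 σ, le_rfl]
  have h1 : ∑ σ ∈ (loops n n).filter (0 ∈ minSet ·), loopWeight β σ * G σ
      ≤ Real.exp (2 * β) *
        ∑ σ ∈ (loops n (n + 1)).filter (0 ∈ minSet ·), loopWeight β σ * G' σ := by
    have hinj : Function.Injective (raiseOff (n := n)) := fun σ τ h => add_right_cancel h
    have hsub : ((loops n n).filter (0 ∈ minSet ·)).image raiseOff
        ⊆ (loops n (n + 1)).filter (0 ∈ minSet ·) := by
      intro τ hτ
      obtain ⟨σ, hσ, rfl⟩ := Finset.mem_image.1 hτ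
      rw [Finset.mem_filter, mem_loops] at hσ
      rw [Finset.mem_filter, mem_loops, minSet_raiseOff hσ.2]
      refine ⟨⟨by simp [raiseOff, hσ.1.1], fun i j => ?_⟩, Finset.mem_singleton_self 0⟩
      have := hσ.1.2 i j
      simp only [raiseOff, Pi.add_apply]
      push_cast
      split_ifs <;> omega
    rw [Finset.mul_sum]
    calc _ ≤ ∑ σ ∈ (loops n n).filter (0 ∈ minSet ·),
          Real.exp (2 * β) * (loopWeight β (raiseOff σ) * G' (raiseOff σ)) := by
          refine Finset.sum_le_sum fun σ hσ => ?_
          rw [Finset.mem_filter] at hσ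
          have e : G' (raiseOff σ) = G (raiseOff σ) := by
            simp [hG', minSet_raiseOff hσ.2]
          rw [e, ← mul_assoc]
          exact mul_le_mul (loopWeight_le_of_energy hβ (loopEnergy_raiseOff_le σ))
            (hmono σ hσ.2) (hG0 σ) (mul_pos (Real.exp_pos _) (loopWeight_pos β _)).le
      _ = ∑ σ ∈ ((loops n n).filter (0 ∈ minSet ·)).image raiseOff,
          Real.exp (2 * β) * (loopWeight β σ * G' σ) := by
          rw [Finset.sum_image fun x _ y _ h => hinj h]
      _ ≤ _ := Finset.sum_le_sum_of_subset_of_nonneg hsub fun σ _ _ =>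
          mul_nonneg (Real.exp_pos _).le (mul_nonneg (loopWeight_pos β _).le (hG'0 σ))
  have h2 := sum_card_minSet_inter β (n + 1) hG'rot Finset.univ
  rw [Finset.card_univ, Fintype.card_fin] at h2
  push_cast at h2
  calc _ ≤ (n + 1) * (Real.exp (2 * β) *
        ∑ σ ∈ (loops n (n + 1)).filter (0 ∈ minSet ·), loopWeight β σ * G' σ) := by gcongr
    _ = Real.exp (2 * β) * ((n + 1) *
        ∑ σ ∈ (loops n (n + 1)).filter (0 ∈ minSet ·), loopWeight β σ * G' σ) := by ring
    _ ≤ _ := by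
        rw [← h2]
        gcongr with σ hσ
        · exact (loopWeight_pos β σ).le
        · simp only [hG', Finset.univ_inter]
          split_ifs with h
          · simp [h]
          · simpa using hG0 σ

/-- The cyclic lemma counts each loop once per minimum, and every loop has one. -/
lemma sum_loops_le_mul_sum_excursions (β : ℝ) {G : Loop n → ℝ}
    (hG : ∀ c σ, G (rot c σ) = G σ) (hG0 : ∀ σ, 0 ≤ G σ) :
    ∑ σ ∈ loops n n, loopWeight β σ * G σ
      ≤ (n + 1) * ∑ σ ∈ (loops n n).filter (0 ∈ minSet ·), loopWeight β σ * G σ := by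
  have h2 := sum_card_minSet_inter β n hG Finset.univ
  rw [Finset.card_univ, Fintype.card_fin] at h2
  push_cast at h2
  rw [← h2]
  refine Finset.sum_le_sum fun σ _ => mul_le_mul_of_nonneg_left ?_ (loopWeight_pos β σ).le
  refine le_mul_of_one_le_right (hG0 σ) ?_
  rw [Finset.univ_inter]
  exact_mod_cast (minSet_nonempty σ).card_pos

/-- The position of a uniformly chosen minimum is uniform. -/
lemma sum_minSet_fraction (β : ℝ) (K : ℕ) (J : Finset (Fin (n + 1))) :
    (n + 1) * ∑ σ ∈ loops n K,
        loopWeight β σ * (((J ∩ minSet σ).card : ℝ) / ((minSet σ).card : ℝ))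
      = J.card * ∑ σ ∈ loops n K, loopWeight β σ := by
  have hG : ∀ c (σ : Loop n), 1 / (((minSet (rot c σ)).card : ℕ) : ℝ) = 1 / ((minSet σ).card : ℝ) := by
    intro c σ; rw [card_minSet_rot]
  have h1 := sum_card_minSet_inter β K (G := fun σ => 1 / ((minSet σ).card : ℝ)) hG J
  have h2 := sum_card_minSet_inter β K (G := fun σ => 1 / ((minSet σ).card : ℝ)) hG Finset.univ
  rw [Finset.card_univ, Fintype.card_fin] at h2
  have e1 : ∀ σ : Loop n, 1 / ((minSet σ).card : ℝ) * ((J ∩ minSet σ).card : ℝ)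
      = ((J ∩ minSet σ).card : ℝ) / ((minSet σ).card : ℝ) := fun σ => by ring
  have e2 : ∀ σ : Loop n, 1 / ((minSet σ).card : ℝ) * ((Finset.univ ∩ minSet σ).card : ℝ) = 1 := by
    intro σ
    have := (minSet_nonempty σ).card_pos
    rw [Finset.univ_inter]
    field_simp
  simp only [e1] at h1
  simp only [e2, mul_one] at h2
  rw [h1, h2]
  push_cast
  ring

end Loops

/-! ### Shift families: almost uncorrelated scores and anticoncentration -/

section Shifts

variable {n : ℕ}

lemma sum_weight_mul_sq_le {ι : Type*} (s : Finset ι) {w : ι → ℝ} (hw : ∀ i, 0 ≤ w i)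
    (f g : ι → ℝ) :
    (∑ i ∈ s, w i * (f i * g i)) ^ 2 ≤ (∑ i ∈ s, w i * f i ^ 2) * ∑ i ∈ s, w i * g i ^ 2 := by
  have := Finset.sum_mul_sq_le_sq_mul_sq s
    (fun i => Real.sqrt (w i) * f i) (fun i => Real.sqrt (w i) * g i)
  simp only [mul_pow, Real.sq_sqrt (hw _)] at this
  refine le_trans (le_of_eq ?_) this
  congr 1
  refine Finset.sum_congr rfl fun i _ => ?_
  have := Real.mul_self_sqrt (hw i)
  linear_combination (-(f i * g i)) * this

/-- The indicator of a loop with height differences of at least `n`. -/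
noncomputable def tall (σ : Loop n) : ℝ :=
  open Classical in if ∃ i j, (n : ℤ) ≤ σ i - σ j then 1 else 0

lemma tall_nonneg (σ : Loop n) : 0 ≤ tall σ := by
  unfold tall; split_ifs <;> norm_num

/-- A family of `m` elementary shifts of a loop whose edges are pairwise disjoint. -/
structure IsShiftFamily (m : ℕ) (e : ℕ → Loop n) : Prop where
  zero : ∀ s < m, e s 0 = 0
  zero_or_one : ∀ s < m, ∀ i, e s i = 0 ∨ e s i = 1
  sum_steps : ∀ s < m, ∑ i, |step (e s) i| ≤ 2
  disjoint : ∀ s < m, ∀ s' < m, s ≠ s' → ∀ i, step (e s) i = 0 ∨ step (e s') i = 0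

/-- The density of the law of `σ + e`. -/
noncomputable def ratio (β : ℝ) (e σ : Loop n) : ℝ := loopWeight β (σ - e) / loopWeight β σ

lemma loopWeight_mul_ratio (β : ℝ) (e σ : Loop n) :
    loopWeight β σ * ratio β e σ = loopWeight β (σ - e) :=
  mul_div_cancel₀ _ (loopWeight_pos β σ).ne'

lemma ratio_pos (β : ℝ) (e σ : Loop n) : 0 < ratio β e σ :=
  div_pos (loopWeight_pos β _) (loopWeight_pos β _)

/-- The density for e' depends only on the edges that e' alters, and e leaves these alone. This is
the source of the near independence of the scores. -/
lemma ratio_add {β : ℝ} {e e' : Loop n} (h : ∀ i, step e i = 0 ∨ step e' i = 0) (σ : Loop n) :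
    ratio β e' (σ + e) = ratio β e' σ := by
  unfold ratio loopWeight
  rw [← Real.exp_sub, ← Real.exp_sub]
  have : loopEnergy (σ + e - e') - loopEnergy (σ + e) = loopEnergy (σ - e') - loopEnergy σ := by
    unfold loopEnergy
    rw [← Finset.sum_sub_distrib, ← Finset.sum_sub_distrib]
    refine Finset.sum_congr rfl fun i _ => ?_
    have e1 : step (σ + e - e') i = step σ i + step e i - step e' i := by
      simp only [step, Pi.add_apply, Pi.sub_apply]; ring
    have e2 : step (σ + e) i = step σ i + step e i := by
      simp only [step, Pi.add_apply]; ring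
    have e3 : step (σ - e') i = step σ i - step e' i := by
      simp only [step, Pi.sub_apply]; ring
    rw [e1, e2, e3]
    rcases h i with h | h <;> rw [h] <;> ring_nf
  have h2 : (loopEnergy (σ + e - e') : ℝ) - loopEnergy (σ + e)
      = loopEnergy (σ - e') - loopEnergy σ := by exact_mod_cast this
  congr 1
  linear_combination (-β) * h2

namespace IsShiftFamily

variable {m : ℕ} {e : ℕ → Loop n} {β : ℝ}

lemma ratio_le (h : IsShiftFamily m e) (hβ : 0 < β) {s : ℕ} (hs : s < m) (σ : Loop n) :
    ratio β (e s) σ ≤ Real.exp (2 * β) := by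
  unfold ratio
  rw [div_le_iff₀ (loopWeight_pos β σ)]
  apply loopWeight_le_of_energy hβ
  have := loopEnergy_add_le (σ - e s) (e s)
  rw [sub_add_cancel] at this
  have := h.sum_steps s hs
  omega

lemma abs_ratio_sub_one_le (h : IsShiftFamily m e) (hβ : 0 < β) {s : ℕ} (hs : s < m)
    (σ : Loop n) : |ratio β (e s) σ - 1| ≤ Real.exp (2 * β) := by
  have h1 := h.ratio_le hβ hs σ
  have h2 := ratio_pos β (e s) σ
  have h3 : 1 ≤ Real.exp (2 * β) := Real.one_le_exp (by linarith)
  rw [abs_le]; constructor <;> linarith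

lemma add_mem (h : IsShiftFamily m e) {s : ℕ} (hs : s < m) {σ : Loop n} (hσ : σ ∈ loops n n) :
    σ + e s ∈ loops n (n + 1) := by
  rw [mem_loops] at hσ ⊢
  refine ⟨by simp [hσ.1, h.zero s hs], fun i j => ?_⟩
  have := hσ.2 i j
  simp only [Pi.add_apply]
  push_cast
  rcases h.zero_or_one s hs i with h1 | h1 <;> rcases h.zero_or_one s hs j with h2 | h2 <;>
    rw [h1, h2] <;> omega

/-- A shift changes height differences by at most one, so it leaves the set only if some difference
is already n. -/
lemma tall_eq_one (h : IsShiftFamily m e) {s : ℕ} (hs : s < m) {σ : Loop n}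
    (hσ : σ ∈ loops n n) (hn : σ + e s ∉ loops n n ∨ σ - e s ∉ loops n n) : tall σ = 1 := by
  unfold tall
  rw [if_pos]
  by_contra! hc
  rw [mem_loops] at hσ
  rcases hn with hn | hn <;>
  · apply hn
    rw [mem_loops]
    refine ⟨by simp [hσ.1, h.zero s hs], fun i j => ?_⟩
    have := hc i j
    simp only [Pi.add_apply, Pi.sub_apply]
    rcases h.zero_or_one s hs i with h1 | h1 <;> rcases h.zero_or_one s hs j with h2 | h2 <;>
      rw [h1, h2] <;> omega

/-- The change of variables `σ ↦ σ + e s`, up to the loops of extreme height. -/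
lemma abs_sum_ratio_sub_le (h : IsShiftFamily m e) (hβ : 0 < β) {s : ℕ} (hs : s < m)
    {g : Loop n → ℝ} {K : ℝ} (hg : ∀ σ ∈ loops n (n + 1), |g σ| ≤ K) :
    |∑ σ ∈ loops n n, loopWeight β σ * (ratio β (e s) σ * g σ)
        - ∑ σ ∈ loops n n, loopWeight β σ * g (σ + e s)|
      ≤ 2 * Real.exp (2 * β) * K * ∑ σ ∈ loops n n, loopWeight β σ * tall σ := by
  have hK : 0 ≤ K := (abs_nonneg _).trans (hg 0 (mem_loops.2 ⟨rfl, fun i j => by simp; omega⟩))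
  have h1e : 1 ≤ Real.exp (2 * β) := Real.one_le_exp (by linarith)
  rw [← Finset.sum_filter_add_sum_filter_not (loops n n) (fun σ => σ - e s ∈ loops n n),
    ← Finset.sum_filter_add_sum_filter_not (loops n n) (fun σ => σ + e s ∈ loops n n)
      (fun σ => loopWeight β σ * g (σ + e s))]
  have hmain : ∑ σ ∈ (loops n n).filter (fun σ => σ - e s ∈ loops n n),
        loopWeight β σ * (ratio β (e s) σ * g σ)
      = ∑ σ ∈ (loops n n).filter (fun σ => σ + e s ∈ loops n n),
        loopWeight β σ * g (σ + e s) := by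
    refine Finset.sum_nbij' (· - e s) (· + e s) ?_ ?_ ?_ ?_ ?_
    · intro σ hσ
      rw [Finset.mem_filter] at hσ ⊢
      exact ⟨hσ.2, by rw [sub_add_cancel]; exact hσ.1⟩
    · intro σ hσ
      rw [Finset.mem_filter] at hσ ⊢
      exact ⟨hσ.2, by rw [add_sub_cancel_right]; exact hσ.1⟩
    · intro σ _; exact sub_add_cancel _ _
    · intro σ _; exact add_sub_cancel_right _ _
    · intro σ _
      rw [sub_add_cancel, ← mul_assoc, loopWeight_mul_ratio]
  rw [hmain, add_sub_add_left_eq_sub]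
  have hA : |∑ σ ∈ (loops n n).filter (fun σ => ¬ σ - e s ∈ loops n n),
        loopWeight β σ * (ratio β (e s) σ * g σ)|
      ≤ Real.exp (2 * β) * K * ∑ σ ∈ loops n n, loopWeight β σ * tall σ := by
    rw [Finset.mul_sum]
    refine (Finset.abs_sum_le_sum_abs _ _).trans ?_
    refine le_trans (Finset.sum_le_sum fun σ hσ => ?_) (Finset.sum_le_sum_of_subset_of_nonneg
      (Finset.filter_subset (fun σ => ¬ σ - e s ∈ loops n n) _) fun σ _ _ =>
        mul_nonneg (mul_nonneg (Real.exp_pos _).le hK)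
          (mul_nonneg (loopWeight_pos β σ).le (tall_nonneg σ)))
    rw [Finset.mem_filter] at hσ
    rw [h.tall_eq_one hs hσ.1 (Or.inr hσ.2), mul_one, abs_mul, abs_mul,
      abs_of_pos (loopWeight_pos β σ), abs_of_pos (ratio_pos β _ σ), mul_comm]
    refine mul_le_mul_of_nonneg_right ?_ (loopWeight_pos β σ).le
    refine mul_le_mul (h.ratio_le hβ hs σ) (hg σ ?_) (abs_nonneg _) (Real.exp_pos _).le
    rw [mem_loops] at hσ ⊢
    refine ⟨hσ.1.1, fun i j => ?_⟩
    have := hσ.1.2 i j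
    push_cast
    omega
  have hB : |∑ σ ∈ (loops n n).filter (fun σ => ¬ σ + e s ∈ loops n n),
        loopWeight β σ * g (σ + e s)|
      ≤ K * ∑ σ ∈ loops n n, loopWeight β σ * tall σ := by
    rw [Finset.mul_sum]
    refine (Finset.abs_sum_le_sum_abs _ _).trans ?_
    refine le_trans (Finset.sum_le_sum fun σ hσ => ?_) (Finset.sum_le_sum_of_subset_of_nonneg
      (Finset.filter_subset (fun σ => ¬ σ + e s ∈ loops n n) _) fun σ _ _ =>
        mul_nonneg hK (mul_nonneg (loopWeight_pos β σ).le (tall_nonneg σ)))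
    rw [Finset.mem_filter] at hσ
    rw [h.tall_eq_one hs hσ.1 (Or.inl hσ.2), mul_one, abs_mul,
      abs_of_pos (loopWeight_pos β σ), mul_comm]
    exact mul_le_mul_of_nonneg_right (hg _ (h.add_mem hs hσ.1)) (loopWeight_pos β σ).le
  have hT : 0 ≤ ∑ σ ∈ loops n n, loopWeight β σ * tall σ :=
    Finset.sum_nonneg fun σ _ => mul_nonneg (loopWeight_pos β σ).le (tall_nonneg σ)
  refine (abs_sub _ _).trans ((add_le_add hA hB).trans ?_)
  have : K * ∑ σ ∈ loops n n, loopWeight β σ * tall σ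
      ≤ Real.exp (2 * β) * (K * ∑ σ ∈ loops n n, loopWeight β σ * tall σ) :=
    le_mul_of_one_le_left (mul_nonneg hK hT) h1e
  linarith

/-- The sum of the centered densities has the second moment of a sum of uncorrelated terms. -/
lemma sum_sq_score_le (h : IsShiftFamily m e) (hβ : 0 < β)
    (htall : m * ∑ σ ∈ loops n n, loopWeight β σ * tall σ ≤ ∑ σ ∈ loops n n, loopWeight β σ) :
    ∑ σ ∈ loops n n, loopWeight β σ * (∑ s ∈ Finset.range m, (ratio β (e s) σ - 1)) ^ 2
      ≤ 3 * Real.exp (2 * β) ^ 2 * m * ∑ σ ∈ loops n n, loopWeight β σ := by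
  set Z := ∑ σ ∈ loops n n, loopWeight β σ with hZ
  set T := ∑ σ ∈ loops n n, loopWeight β σ * tall σ with hT
  set E := Real.exp (2 * β) with hE
  have hE0 : 0 < E := Real.exp_pos _
  have hZ0 : 0 ≤ Z := Finset.sum_nonneg fun σ _ => (loopWeight_pos β σ).le
  have hT0 : 0 ≤ T :=
    Finset.sum_nonneg fun σ _ => mul_nonneg (loopWeight_pos β σ).le (tall_nonneg σ)
  have hexp : ∑ σ ∈ loops n n, loopWeight β σ * (∑ s ∈ Finset.range m, (ratio β (e s) σ - 1)) ^ 2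
      = ∑ s ∈ Finset.range m, ∑ s' ∈ Finset.range m, ∑ σ ∈ loops n n,
        loopWeight β σ * ((ratio β (e s) σ - 1) * (ratio β (e s') σ - 1)) := by
    simp only [sq, Finset.sum_mul_sum]
    simp only [Finset.mul_sum]
    rw [Finset.sum_comm]
    refine Finset.sum_congr rfl fun s _ => ?_
    rw [Finset.sum_comm]
  rw [hexp]
  have hdiag : ∀ s < m, ∑ σ ∈ loops n n,
      loopWeight β σ * ((ratio β (e s) σ - 1) * (ratio β (e s) σ - 1)) ≤ E ^ 2 * Z := by
    intro s hs
    rw [hZ, Finset.mul_sum]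
    refine Finset.sum_le_sum fun σ _ => ?_
    rw [mul_comm]
    refine mul_le_mul_of_nonneg_right ?_ (loopWeight_pos β σ).le
    rw [← sq, ← sq_abs]
    exact pow_le_pow_left₀ (abs_nonneg _) (h.abs_ratio_sub_one_le hβ hs σ) 2
  -- The change of variables along `e s` leaves the factor for s' unchanged by `ratio_add`, so the
  -- covariance reduces to the boundary error from tall loops.
  have hoff : ∀ s < m, ∀ s' < m, s ≠ s' → ∑ σ ∈ loops n n,
      loopWeight β σ * ((ratio β (e s) σ - 1) * (ratio β (e s') σ - 1)) ≤ 2 * E ^ 2 * T := by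
    intro s hs s' hs' hne
    have := h.abs_sum_ratio_sub_le hβ hs (g := fun σ => ratio β (e s') σ - 1)
      fun σ _ => h.abs_ratio_sub_one_le hβ hs' σ
    simp only [ratio_add (h.disjoint s hs s' hs' hne)] at this
    rw [← Finset.sum_sub_distrib] at this
    calc _ = ∑ σ ∈ loops n n, (loopWeight β σ * (ratio β (e s) σ * (ratio β (e s') σ - 1))
          - loopWeight β σ * (ratio β (e s') σ - 1)) :=
          Finset.sum_congr rfl fun σ _ => by ring
      _ ≤ 2 * E * E * T := (le_abs_self _).trans this
      _ = _ := by ring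
  calc _ ≤ ∑ s ∈ Finset.range m, ∑ s' ∈ Finset.range m,
        ((if s = s' then E ^ 2 * Z else 0) + 2 * E ^ 2 * T) := by
        refine Finset.sum_le_sum fun s hs => Finset.sum_le_sum fun s' hs' => ?_
        rw [Finset.mem_range] at hs hs'
        by_cases hss : s = s'
        · subst hss
          rw [if_pos rfl]
          have := hdiag s hs
          have : 0 ≤ 2 * E ^ 2 * T := by positivity
          linarith
        · rw [if_neg hss, zero_add]
          exact hoff s hs s' hs' hss
    _ = m * (E ^ 2 * Z) + m * (m * (2 * E ^ 2 * T)) := by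
        simp only [Finset.sum_add_distrib, Finset.sum_ite_eq]
        rw [Finset.sum_congr rfl fun s hs => if_pos hs]
        simp
    _ ≤ m * (E ^ 2 * Z) + m * (2 * E ^ 2 * Z) := by
        have h1 : (m : ℝ) * (2 * E ^ 2 * T) ≤ 2 * E ^ 2 * Z := by
          have := mul_le_mul_of_nonneg_left htall (by positivity : (0 : ℝ) ≤ 2 * E ^ 2)
          linarith
        gcongr
    _ = _ := by ring

/-- A functional that every shift increases by one has no atom heavier than `O(1 / √m)`. -/
lemma sum_fiber_le (h : IsShiftFamily m e) (hβ : 0 < β)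
    (htall : m * ∑ σ ∈ loops n n, loopWeight β σ * tall σ ≤ ∑ σ ∈ loops n n, loopWeight β σ)
    {gap : Loop n → ℤ} (hgap : ∀ s < m, ∀ σ, gap (σ + e s) = gap σ + 1) (x : ℤ) :
    Real.sqrt m * ∑ σ ∈ loops n n, loopWeight β σ * (if gap σ = x then 1 else 0)
      ≤ 4 * Real.exp (2 * β) * ∑ σ ∈ loops n n, loopWeight β σ := by
  have hscore := h.sum_sq_score_le hβ htall
  set Z := ∑ σ ∈ loops n n, loopWeight β σ with hZ
  set T := ∑ σ ∈ loops n n, loopWeight β σ * tall σ with hT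
  set E := Real.exp (2 * β) with hE
  set H : Loop n → ℝ := fun σ => ∑ s ∈ Finset.range m, (ratio β (e s) σ - 1) with hH
  set g : Loop n → ℝ := fun σ => if gap σ ≤ x then 1 else 0 with hg
  have hE0 : 1 ≤ E := Real.one_le_exp (by linarith)
  have hZ0 : 0 ≤ Z := Finset.sum_nonneg fun σ _ => (loopWeight_pos β σ).le
  have hg1 : ∀ σ, |g σ| ≤ 1 := by
    intro σ; simp only [hg]; split_ifs <;> simp
  set p := ∑ σ ∈ loops n n, loopWeight β σ * (if gap σ = x then (1 : ℝ) else 0) with hp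
  have hp0 : 0 ≤ p := Finset.sum_nonneg fun σ _ => mul_nonneg (loopWeight_pos β σ).le
    (by split_ifs <;> norm_num)
  -- Shifting turns the indicator of gap ≤ x into that of gap ≤ x - 1; the loss is exactly the atom
  -- at x. Thus the atom is a correlation with the centered density, up to the boundary error.
  have hshift : ∀ s ∈ Finset.range m,
      p ≤ 2 * E * T - ∑ σ ∈ loops n n, loopWeight β σ * ((ratio β (e s) σ - 1) * g σ) := by
    intro s hs
    rw [Finset.mem_range] at hs
    have := h.abs_sum_ratio_sub_le hβ hs (g := g) fun σ _ => hg1 σ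
    have h1 := (abs_le.1 this).2
    have h2 : ∑ σ ∈ loops n n, loopWeight β σ * g (σ + e s)
        = (∑ σ ∈ loops n n, loopWeight β σ * g σ) - p := by
      rw [hp, ← Finset.sum_sub_distrib]
      refine Finset.sum_congr rfl fun σ _ => ?_
      rw [← mul_sub]
      congr 1
      simp only [hg, hgap s hs]
      by_cases h3 : gap σ = x
      · simp [h3]
      · by_cases h4 : gap σ ≤ x
        · rw [if_pos (by omega), if_pos h4, if_neg h3]; ring
        · rw [if_neg (by omega), if_neg h4, if_neg h3]; ring
    have h3 : ∑ σ ∈ loops n n, loopWeight β σ * ((ratio β (e s) σ - 1) * g σ)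
        = ∑ σ ∈ loops n n, loopWeight β σ * (ratio β (e s) σ * g σ)
          - ∑ σ ∈ loops n n, loopWeight β σ * g σ := by
      rw [← Finset.sum_sub_distrib]
      exact Finset.sum_congr rfl fun σ _ => by ring
    linarith
  have hsum : m * p ≤ m * (2 * E * T) - ∑ σ ∈ loops n n, loopWeight β σ * (H σ * g σ) := by
    have h1 := Finset.sum_le_sum hshift
    rw [Finset.sum_sub_distrib, Finset.sum_const, Finset.sum_const, Finset.card_range,
      nsmul_eq_mul, nsmul_eq_mul, Finset.sum_comm (s := Finset.range m)] at h1
    have h2 : ∀ σ, loopWeight β σ * (H σ * g σ)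
        = ∑ s ∈ Finset.range m, loopWeight β σ * ((ratio β (e s) σ - 1) * g σ) := by
      intro σ
      rw [hH, Finset.sum_mul, Finset.mul_sum]
    simp only [h2]
    exact h1
  have hcs : (∑ σ ∈ loops n n, loopWeight β σ * (H σ * g σ)) ^ 2 ≤ (2 * E * Real.sqrt m * Z) ^ 2 := by
    refine (sum_weight_mul_sq_le _ (fun σ => (loopWeight_pos β σ).le) H g).trans ?_
    have h1 : ∑ σ ∈ loops n n, loopWeight β σ * g σ ^ 2 ≤ Z := by
      refine Finset.sum_le_sum fun σ _ => mul_le_of_le_one_right (loopWeight_pos β σ).le ?_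
      rw [← sq_abs]
      exact pow_le_one₀ (abs_nonneg _) (hg1 σ)
    calc _ ≤ (3 * E ^ 2 * m * Z) * Z := mul_le_mul hscore h1
          (Finset.sum_nonneg fun σ _ => mul_nonneg (loopWeight_pos β σ).le (sq_nonneg _))
          (by positivity)
      _ ≤ _ := by
        rw [mul_pow, mul_pow, mul_pow, Real.sq_sqrt (Nat.cast_nonneg m)]
        have : 0 ≤ E ^ 2 * m * Z ^ 2 := by positivity
        nlinarith
  have habs := abs_le_of_sq_le_sq hcs (by positivity)
  rcases Nat.eq_zero_or_pos m with hm | hm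
  · rw [hm, Nat.cast_zero, Real.sqrt_zero, zero_mul]
    positivity
  have hm1 : 1 ≤ Real.sqrt m := by
    rw [Real.one_le_sqrt]; exact_mod_cast hm
  have hss : Real.sqrt m * Real.sqrt m = m := Real.mul_self_sqrt (Nat.cast_nonneg m)
  have h5 : Real.sqrt m * (Real.sqrt m * p) ≤ Real.sqrt m * (4 * E * Z) := by
    rw [← mul_assoc, hss]
    have h6 : (m : ℝ) * (2 * E * T) ≤ 2 * E * Z := by
      have := mul_le_mul_of_nonneg_left htall (by positivity : (0 : ℝ) ≤ 2 * E)
      linarith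
    have h7 : 2 * E * Z ≤ Real.sqrt m * (2 * E * Z) := le_mul_of_one_le_left (by positivity) hm1
    have h8 := (abs_le.1 habs).1
    linarith
  exact le_of_mul_le_mul_left h5 (by linarith)

end IsShiftFamily

end Shifts

/-! ### Plateau shifts, the response of the area, and the cutoff -/

section AreaVariance

variable {n : ℕ}

lemma card_filter_fin (p : ℕ → Prop) [DecidablePred p] :
    (Finset.univ.filter fun i : Fin (n + 1) => p i.val).card
      = ((Finset.range (n + 1)).filter p).card := by
  rw [Finset.card_filter, Finset.card_filter, ← Fin.sum_univ_eq_sum_range (fun k => if p k then 1 else 0)]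

/-- The indicator of the positions from `m + s` to `b - s - 1`. -/
def bump (n m b s : ℕ) : Loop n := fun i => if m + s ≤ i.val ∧ i.val + s < b then 1 else 0

lemma step_bump {m b s : ℕ} (hm : 1 ≤ m) (hb : b ≤ n) (i : Fin (n + 1)) :
    |step (bump n m b s) i| ≤ (if i.val + 1 = m + s then 1 else 0)
      + (if i.val + 1 + s = b then 1 else 0) ∧
    (step (bump n m b s) i ≠ 0 → i.val + 1 = m + s ∨ i.val + 1 + s = b) := by
  have hv : (i + 1).val = i.val + 1 ∨ (i + 1).val = 0 ∧ i.val = n := by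
    rw [Fin.val_add_one]
    split_ifs with h
    · right; subst h; simp
    · left; rfl
  simp only [step, bump]
  generalize (i + 1).val = j at *
  generalize i.val = k at *
  constructor
  · split_ifs <;> first | omega | simp
  · split_ifs <;> omega

lemma sum_ite_val_le_one (c : ℕ) (f : ℕ → ℕ) (hf : Function.Injective f) :
    ∑ i : Fin (n + 1), (if f i.val = c then (1 : ℤ) else 0) ≤ 1 := by
  rw [← Finset.sum_filter, Finset.sum_const, nsmul_eq_mul, mul_one]
  have : (Finset.univ.filter fun i : Fin (n + 1) => f i.val = c).card ≤ 1 := by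
    rw [Finset.card_le_one]
    intro a ha b hb
    rw [Finset.mem_filter] at ha hb
    exact Fin.ext (hf (ha.2.trans hb.2.symm))
  exact_mod_cast this

/-- The plateaus are nested. Their left ends lie in [m, 2m) and their right ends in (b - m, b], so 3
* m ≤ b keeps all altered edges distinct. -/
lemma isShiftFamily_bump {m b : ℕ} (hm : 1 ≤ m) (hb : b ≤ n) (hmb : 3 * m ≤ b) :
    IsShiftFamily m (bump n m b) where
  zero s _ := by simp [bump]; omega
  zero_or_one s _ i := by simp only [bump]; split_ifs <;> simp
  sum_steps s _ := by
    refine (Finset.sum_le_sum fun i _ => (step_bump hm hb i).1).trans ?_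
    rw [Finset.sum_add_distrib]
    have h1 := sum_ite_val_le_one (n := n) (m + s) (fun k => k + 1) fun a b h => by simpa using h
    have h2 := sum_ite_val_le_one (n := n) b (fun k => k + 1 + s) fun a b h => by simpa using h
    exact (add_le_add h1 h2).trans (by norm_num)
  disjoint s hs s' hs' hne i := by
    by_contra! hc
    have h1 := (step_bump hm hb i).2 hc.1
    have h2 := (step_bump hm hb i).2 hc.2
    omega

/-- The minimum rises by at most one, and does not rise if some minimum is left in place. -/
lemma area_add_sub_ge {e σ : Loop n} (he : ∀ i, e i = 0 ∨ e i = 1) :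
    ∑ i, e i - (n + 1) ≤ area (σ + e) - area σ ∧
    ((∃ i ∈ minSet σ, e i = 0) → ∑ i, e i ≤ area (σ + e) - area σ) := by
  have key : area (σ + e) - area σ = ∑ i, e i - (n + 1) * (minVal (σ + e) - minVal σ) := by
    unfold area
    simp only [Pi.add_apply, Finset.sum_add_distrib]
    ring
  rw [key]
  constructor
  · obtain ⟨i, hi⟩ := minSet_nonempty σ
    have h1 := minVal_le (σ + e) i
    rw [Pi.add_apply, ← minVal_eq hi] at h1
    have : minVal (σ + e) - minVal σ ≤ 1 := by
      rcases he i with h | h <;> rw [h] at h1 <;> omega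
    nlinarith
  · rintro ⟨i, hi, h0⟩
    have h1 := minVal_le (σ + e) i
    rw [Pi.add_apply, ← minVal_eq hi, h0] at h1
    have : minVal (σ + e) - minVal σ ≤ 0 := by omega
    nlinarith

lemma area_mem {K : ℕ} {σ : Loop n} (hσ : σ ∈ loops n K) :
    0 ≤ area σ ∧ area σ ≤ (n + 1) * K := by
  have e : area σ = ∑ i, (σ i - minVal σ) := by
    unfold area
    simp [Finset.sum_sub_distrib]
  rw [e]
  constructor
  · exact Finset.sum_nonneg fun i _ => sub_nonneg.2 (minVal_le σ i)
  · obtain ⟨j, hj⟩ := minSet_nonempty σ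
    calc _ ≤ ∑ _i : Fin (n + 1), (K : ℤ) := Finset.sum_le_sum fun i _ => by
          rw [minVal_eq hj]; exact (mem_loops.1 hσ).2 i j
      _ = _ := by simp

/-- The difference between the minima over the core of the bumps and over the complement of
their union. -/
noncomputable def minGap (core J : Finset (Fin (n + 1))) (hc : core.Nonempty) (hJ : J.Nonempty)
    (σ : Loop n) : ℤ := core.inf' hc σ - J.inf' hJ σ

lemma inf'_add_const {A : Finset (Fin (n + 1))} (hA : A.Nonempty) {σ e : Loop n} {a : ℤ}
    (he : ∀ i ∈ A, e i = a) : A.inf' hA (σ + e) = A.inf' hA σ + a := by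
  apply le_antisymm
  · obtain ⟨i, hi, h⟩ := Finset.exists_mem_eq_inf' hA σ
    rw [h, ← he i hi]
    exact Finset.inf'_le _ hi
  · refine Finset.le_inf' _ _ fun i hi => ?_
    rw [Pi.add_apply, he i hi]
    exact add_le_add_left (Finset.inf'_le _ hi) _

lemma minGap_add {core J : Finset (Fin (n + 1))} {hc : core.Nonempty} {hJ : J.Nonempty}
    {e : Loop n} (h1 : ∀ i ∈ core, e i = 1) (h0 : ∀ i ∈ J, e i = 0) (σ : Loop n) :
    minGap core J hc hJ (σ + e) = minGap core J hc hJ σ + 1 := by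
  unfold minGap
  rw [inf'_add_const hc h1, inf'_add_const hJ h0]
  ring

lemma minGap_nonneg {core J : Finset (Fin (n + 1))} {hc : core.Nonempty} {hJ : J.Nonempty}
    {σ : Loop n} {i : Fin (n + 1)} (hi : i ∈ J) (hm : i ∈ minSet σ) :
    0 ≤ minGap core J hc hJ σ := by
  have h1 : J.inf' hJ σ ≤ σ i := Finset.inf'_le _ hi
  have h2 : σ i ≤ core.inf' hc σ := Finset.le_inf' _ _ fun j _ => mem_minSet.1 hm j
  unfold minGap
  omega

lemma minGap_nonpos {core J : Finset (Fin (n + 1))} {hc : core.Nonempty} {hJ : J.Nonempty}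
    {σ : Loop n} {i : Fin (n + 1)} (hi : i ∈ core) (hm : i ∈ minSet σ) :
    minGap core J hc hJ σ ≤ 0 := by
  have h1 : core.inf' hc σ ≤ σ i := Finset.inf'_le _ hi
  have h2 : σ i ≤ J.inf' hJ σ := Finset.le_inf' _ _ fun j _ => mem_minSet.1 hm j
  unfold minGap
  omega

/-- The fraction of minima in J has mean |J| / (n + 1) and is at most the indicator that some
minimum lies in J. The next lemma uses that it is at least the indicator that all do. -/
lemma sum_minSet_meets_ge (β : ℝ) (K : ℕ) (J : Finset (Fin (n + 1))) {f : Loop n → ℝ}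
    (hf0 : ∀ σ, 0 ≤ f σ) (hf : ∀ σ, (J ∩ minSet σ).Nonempty → 1 ≤ f σ) :
    J.card * ∑ σ ∈ loops n K, loopWeight β σ ≤ (n + 1) * ∑ σ ∈ loops n K, loopWeight β σ * f σ := by
  rw [← sum_minSet_fraction]
  refine mul_le_mul_of_nonneg_left (Finset.sum_le_sum fun σ _ =>
    mul_le_mul_of_nonneg_left ?_ (loopWeight_pos β σ).le) (by positivity)
  by_cases h : (J ∩ minSet σ).Nonempty
  · refine le_trans (div_le_one_of_le₀ ?_ (Nat.cast_nonneg _)) (hf σ h)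
    exact_mod_cast Finset.card_le_card Finset.inter_subset_right
  · rw [Finset.not_nonempty_iff_eq_empty.1 h]
    simpa using hf0 σ

lemma sum_minSet_subset_le (β : ℝ) (K : ℕ) (J : Finset (Fin (n + 1))) {f : Loop n → ℝ}
    (hf1 : ∀ σ, f σ ≤ 1) (hf : ∀ σ, ¬ minSet σ ⊆ J → f σ ≤ 0) :
    (n + 1) * ∑ σ ∈ loops n K, loopWeight β σ * f σ ≤ J.card * ∑ σ ∈ loops n K, loopWeight β σ := by
  rw [← sum_minSet_fraction]
  refine mul_le_mul_of_nonneg_left (Finset.sum_le_sum fun σ _ =>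
    mul_le_mul_of_nonneg_left ?_ (loopWeight_pos β σ).le) (by positivity)
  by_cases h : minSet σ ⊆ J
  · rw [Finset.inter_eq_right.2 h, div_self]
    · exact hf1 σ
    · exact_mod_cast (minSet_nonempty σ).card_pos.ne'
  · exact (hf σ h).trans (by positivity)

/-- A ramp from `0` at `0` to `1` at `l`. -/
noncomputable def ramp (l : ℕ) (x : ℤ) : ℝ := max 0 (min 1 ((x : ℝ) / l))

lemma ramp_nonneg (l : ℕ) (x : ℤ) : 0 ≤ ramp l x := le_max_left _ _

lemma ramp_le_one (l : ℕ) (x : ℤ) : ramp l x ≤ 1 := max_le zero_le_one (min_le_left _ _)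

lemma ramp_eq_zero {l : ℕ} {x : ℤ} (hx : x ≤ 0) : ramp l x = 0 := by
  have : (x : ℝ) / l ≤ 0 := div_nonpos_of_nonpos_of_nonneg (by exact_mod_cast hx) (Nat.cast_nonneg l)
  exact max_eq_left ((min_le_right _ _).trans this)

lemma ramp_eq_one {l : ℕ} (hl : 1 ≤ l) {x : ℤ} (hx : (l : ℤ) ≤ x) : ramp l x = 1 := by
  have : 1 ≤ (x : ℝ) / l := by
    rw [one_le_div (by positivity)]; exact_mod_cast hx
  rw [ramp, min_eq_left this, max_eq_right zero_le_one]

lemma abs_ramp_sub_le (l : ℕ) (x : ℤ) : |ramp l (x - 1) - ramp l x| ≤ 1 / l := by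
  unfold ramp
  have h : |((x - 1 : ℤ) : ℝ) / l - (x : ℝ) / l| = 1 / l := by
    rw [← sub_div, abs_div, Nat.abs_cast]; simp
  rw [← h]
  refine (abs_max_sub_max_le_max _ _ _ _).trans ?_
  rw [sub_self, abs_zero, max_eq_right (abs_nonneg _)]
  refine (abs_min_sub_min_le_max _ _ _ _).trans ?_
  rw [sub_self, abs_zero, max_eq_right (abs_nonneg _)]

end AreaVariance

/-! ### The Cramér-Rao bound and the variance of the area -/

section AreaVariance

variable {n : ℕ}

namespace IsShiftFamily

variable {m : ℕ} {e : ℕ → Loop n} {β : ℝ}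

/-- At least half of the mass has gap ≥ 0. The l atoms at 0, …, l - 1 carry at most l * 4 * exp (2 *
β) / √m ≤ 1 / 12 of it, and the ramp is one on the rest; 1 / 2 - 1 / 12 ≥ 1 / 3. -/
lemma sum_ramp_ge (h : IsShiftFamily m e) (hβ : 0 < β)
    (htall : m * ∑ σ ∈ loops n n, loopWeight β σ * tall σ ≤ ∑ σ ∈ loops n n, loopWeight β σ)
    {gap : Loop n → ℤ} (hgap : ∀ s < m, ∀ σ, gap (σ + e s) = gap σ + 1)
    (hpos : ∑ σ ∈ loops n n, loopWeight β σ
      ≤ 2 * ∑ σ ∈ loops n n, loopWeight β σ * (if 0 ≤ gap σ then 1 else 0))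
    {l : ℕ} (hl : 1 ≤ l) (hlm : 48 * Real.exp (2 * β) * l ≤ Real.sqrt m) :
    (∑ σ ∈ loops n n, loopWeight β σ) / 3
      ≤ ∑ σ ∈ loops n n, loopWeight β σ * ramp l (gap σ) := by
  have hfib := h.sum_fiber_le hβ htall hgap
  set Z := ∑ σ ∈ loops n n, loopWeight β σ with hZ
  set E := Real.exp (2 * β) with hE
  have hE0 : 0 < E := Real.exp_pos _
  have hZ0 : 0 ≤ Z := Finset.sum_nonneg fun σ _ => (loopWeight_pos β σ).le
  have hl0 : (0 : ℝ) < l := by positivity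
  have hm0 : 0 < Real.sqrt m := lt_of_lt_of_le (by positivity) hlm
  have hpt : ∀ σ : Loop n, (if 0 ≤ gap σ then (1 : ℝ) else 0)
      ≤ ramp l (gap σ) + ∑ x ∈ Finset.range l, if gap σ = (x : ℤ) then (1 : ℝ) else 0 := by
    intro σ
    have hs0 : (0 : ℝ) ≤ ∑ x ∈ Finset.range l, if gap σ = (x : ℤ) then (1 : ℝ) else 0 :=
      Finset.sum_nonneg fun x _ => by split_ifs <;> norm_num
    by_cases h1 : (l : ℤ) ≤ gap σ
    · rw [ramp_eq_one hl h1, if_pos (by omega)]; linarith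
    · by_cases h2 : 0 ≤ gap σ
      · rw [if_pos h2]
        have h3 : (1 : ℝ) ≤ ∑ x ∈ Finset.range l, if gap σ = (x : ℤ) then (1 : ℝ) else 0 := by
          have := Finset.single_le_sum (f := fun x : ℕ => if gap σ = (x : ℤ) then (1 : ℝ) else 0)
            (s := Finset.range l) (fun x _ => by split_ifs <;> norm_num)
            (Finset.mem_range.2 (show (gap σ).toNat < l by omega))
          rwa [if_pos (by omega)] at this
        linarith [ramp_nonneg l (gap σ)]
      · rw [if_neg h2]
        linarith [ramp_nonneg l (gap σ)]
  have hsum : ∑ σ ∈ loops n n, loopWeight β σ * (if 0 ≤ gap σ then (1 : ℝ) else 0)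
      ≤ ∑ σ ∈ loops n n, loopWeight β σ * ramp l (gap σ)
        + ∑ x ∈ Finset.range l, ∑ σ ∈ loops n n,
          loopWeight β σ * (if gap σ = (x : ℤ) then (1 : ℝ) else 0) := by
    rw [Finset.sum_comm, ← Finset.sum_add_distrib]
    refine Finset.sum_le_sum fun σ _ => ?_
    rw [← Finset.mul_sum, ← mul_add]
    exact mul_le_mul_of_nonneg_left (hpt σ) (loopWeight_pos β σ).le
  have hfib2 : ∑ x ∈ Finset.range l, ∑ σ ∈ loops n n,
      loopWeight β σ * (if gap σ = (x : ℤ) then (1 : ℝ) else 0) ≤ Z / 12 := by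
    calc _ ≤ ∑ x ∈ Finset.range l, (4 * E * Z) / Real.sqrt m := by
          refine Finset.sum_le_sum fun x _ => ?_
          rw [le_div_iff₀ hm0, mul_comm]
          exact hfib x
      _ = l * (4 * E * Z) / Real.sqrt m := by
          rw [Finset.sum_const, Finset.card_range, nsmul_eq_mul, ← mul_div_assoc]
      _ ≤ Z / 12 := by
          rw [div_le_iff₀ hm0]
          nlinarith
  linarith

/-- A Cramér-Rao bound: a functional on which the shifts have a drift fluctuates. -/
lemma sq_drift_mul_le (h : IsShiftFamily m e) (hβ : 0 < β)
    (htall : m * ∑ σ ∈ loops n n, loopWeight β σ * tall σ ≤ ∑ σ ∈ loops n n, loopWeight β σ)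
    {gap : Loop n → ℤ} (hgap : ∀ s < m, ∀ σ, gap (σ + e s) = gap σ + 1) {l : ℕ}
    {f : Loop n → ℝ} {K d : ℝ} (hd : 0 ≤ d) (hf : ∀ σ ∈ loops n (n + 1), |f σ| ≤ K)
    (hdrift : ∀ s < m, d * ∑ σ ∈ loops n n, loopWeight β σ
      ≤ ∑ σ ∈ loops n n, loopWeight β σ * (ramp l (gap σ) * (f (σ + e s) - f σ)))
    (herr : 2 * Real.exp (2 * β) * K * ∑ σ ∈ loops n n, loopWeight β σ * tall σ
      ≤ d / 2 * ∑ σ ∈ loops n n, loopWeight β σ) :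
    (m * d / 2) ^ 2 * ∑ σ ∈ loops n n, loopWeight β σ
      ≤ (6 * Real.exp (2 * β) ^ 2 * m + 2 * (m * (1 / l)) ^ 2)
        * ∑ σ ∈ loops n n, loopWeight β σ * f σ ^ 2 := by
  have hscore := h.sum_sq_score_le hβ htall
  set Z := ∑ σ ∈ loops n n, loopWeight β σ with hZ
  set T := ∑ σ ∈ loops n n, loopWeight β σ * tall σ with hT
  set E := Real.exp (2 * β) with hE
  set H : Loop n → ℝ := fun σ => ∑ s ∈ Finset.range m, (ratio β (e s) σ - 1) with hH
  have hZpos : 0 < Z := Finset.sum_pos (fun σ _ => loopWeight_pos β σ)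
    ⟨0, mem_loops.2 ⟨rfl, fun i j => by simp⟩⟩
  -- The argument is lowered by one so that after a shift the cutoff becomes `ramp l (gap σ)`,
  -- matching the drift hypothesis.
  set g : Loop n → ℝ := fun σ => f σ * ramp l (gap σ - 1) with hg
  -- The localized score: the centered densities times the cutoff, plus the discrete derivative of
  -- the cutoff, which is at most 1 / l for each shift.
  set score : Loop n → ℝ := fun σ =>
    H σ * ramp l (gap σ - 1) + m * (ramp l (gap σ - 1) - ramp l (gap σ)) with hs
  have hg1 : ∀ σ ∈ loops n (n + 1), |g σ| ≤ K := by
    intro σ hσ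
    simp only [hg]
    rw [abs_mul, abs_of_nonneg (ramp_nonneg l _)]
    exact (mul_le_of_le_one_right (abs_nonneg _) (ramp_le_one l _)).trans (hf σ hσ)
  have hshift : ∀ s ∈ Finset.range m, d / 2 * Z
      ≤ ∑ σ ∈ loops n n, loopWeight β σ * (f σ * ((ratio β (e s) σ - 1) * ramp l (gap σ - 1)
        + (ramp l (gap σ - 1) - ramp l (gap σ)))) := by
    intro s hs
    rw [Finset.mem_range] at hs
    have h1 := (abs_le.1 (h.abs_sum_ratio_sub_le hβ hs hg1)).1
    have h2 := hdrift s hs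
    have h3 : ∑ σ ∈ loops n n, loopWeight β σ * g (σ + e s)
        = ∑ σ ∈ loops n n, loopWeight β σ * (ramp l (gap σ) * (f (σ + e s) - f σ))
          + ∑ σ ∈ loops n n, loopWeight β σ * (f σ * ramp l (gap σ)) := by
      rw [← Finset.sum_add_distrib]
      refine Finset.sum_congr rfl fun σ _ => ?_
      simp only [hg, hgap s hs, add_sub_cancel_right]
      ring
    have h4 : ∑ σ ∈ loops n n, loopWeight β σ * (f σ * ((ratio β (e s) σ - 1) *
          ramp l (gap σ - 1) + (ramp l (gap σ - 1) - ramp l (gap σ))))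
        = ∑ σ ∈ loops n n, loopWeight β σ * (ratio β (e s) σ * g σ)
          - ∑ σ ∈ loops n n, loopWeight β σ * (f σ * ramp l (gap σ)) := by
      rw [← Finset.sum_sub_distrib]
      refine Finset.sum_congr rfl fun σ _ => ?_
      simp only [hg]
      ring
    linarith
  have hsum : m * d / 2 * Z ≤ ∑ σ ∈ loops n n, loopWeight β σ * (score σ * f σ) := by
    have h1 := Finset.sum_le_sum hshift
    rw [Finset.sum_const, Finset.card_range, nsmul_eq_mul,
      Finset.sum_comm (s := Finset.range m)] at h1
    have h2 : ∀ σ, loopWeight β σ * (score σ * f σ)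
        = ∑ s ∈ Finset.range m, loopWeight β σ * (f σ * ((ratio β (e s) σ - 1) *
          ramp l (gap σ - 1) + (ramp l (gap σ - 1) - ramp l (gap σ)))) := by
      intro σ
      rw [← Finset.mul_sum, ← Finset.mul_sum, Finset.sum_add_distrib, ← Finset.sum_mul,
        Finset.sum_const, Finset.card_range, nsmul_eq_mul, mul_comm (score σ)]
    simp only [h2]
    linarith
  have hscore2 : ∑ σ ∈ loops n n, loopWeight β σ * score σ ^ 2
      ≤ (6 * E ^ 2 * m + 2 * (m * (1 / l)) ^ 2) * Z := by
    calc _ ≤ ∑ σ ∈ loops n n, (2 * (loopWeight β σ * H σ ^ 2)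
          + loopWeight β σ * (2 * (m * (1 / l)) ^ 2)) := by
          refine Finset.sum_le_sum fun σ _ => ?_
          have e1 : score σ ^ 2 ≤ 2 * H σ ^ 2 + 2 * (m * (1 / l)) ^ 2 := by
            have a1 : (H σ * ramp l (gap σ - 1)) ^ 2 ≤ H σ ^ 2 := by
              rw [mul_pow]
              exact mul_le_of_le_one_right (sq_nonneg _)
                (pow_le_one₀ (ramp_nonneg l _) (ramp_le_one l _))
            have a2 : (m * (ramp l (gap σ - 1) - ramp l (gap σ))) ^ 2 ≤ (m * (1 / l)) ^ 2 := by
              rw [mul_pow, mul_pow]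
              refine mul_le_mul_of_nonneg_left ?_ (sq_nonneg _)
              rw [← sq_abs]
              exact pow_le_pow_left₀ (abs_nonneg _) (abs_ramp_sub_le l _) 2
            simp only [hs]
            nlinarith [sq_nonneg (H σ * ramp l (gap σ - 1)
              - m * (ramp l (gap σ - 1) - ramp l (gap σ)))]
          have := mul_le_mul_of_nonneg_left e1 (loopWeight_pos β σ).le
          linarith
      _ = 2 * (∑ σ ∈ loops n n, loopWeight β σ * H σ ^ 2) + Z * (2 * (m * (1 / l)) ^ 2) := by
          rw [Finset.sum_add_distrib, ← Finset.mul_sum, ← Finset.sum_mul]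
      _ ≤ _ := by linarith
  have hcs := sum_weight_mul_sq_le (loops n n) (fun σ => (loopWeight_pos β σ).le) score f
  have hF : 0 ≤ ∑ σ ∈ loops n n, loopWeight β σ * f σ ^ 2 :=
    Finset.sum_nonneg fun σ _ => mul_nonneg (loopWeight_pos β σ).le (sq_nonneg _)
  have h5 : (m * d / 2 * Z) ^ 2 ≤ (6 * E ^ 2 * m + 2 * (m * (1 / l)) ^ 2) * Z
      * ∑ σ ∈ loops n n, loopWeight β σ * f σ ^ 2 :=
    (pow_le_pow_left₀ (by positivity) hsum 2).trans
      (hcs.trans (mul_le_mul_of_nonneg_right hscore2 hF))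
  refine le_of_mul_le_mul_right ?_ hZpos
  calc _ = (m * d / 2 * Z) ^ 2 := by ring
    _ ≤ _ := h5
    _ = _ := by ring

end IsShiftFamily

set_option maxHeartbeats 1000000 in
/-- The area under a loop has variance of order `n ^ 3`. -/
theorem area_variance_ge {β : ℝ} (hβ : 0 < β) : ∃ c : ℝ, 0 < c ∧ ∃ n₀ : ℕ, ∀ n ≥ n₀,
    ((n : ℝ) + 1) * ∑ σ ∈ loops n n, loopWeight β σ * tall σ
      ≤ 1 / (40 * Real.exp (2 * β)) * ∑ σ ∈ loops n n, loopWeight β σ →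
    ∀ a : ℝ, 0 ≤ a → a ≤ ((n : ℝ) + 1) ^ 2 →
      c * ((n : ℝ) + 1) ^ 3 * ∑ σ ∈ loops n n, loopWeight β σ
        ≤ ∑ σ ∈ loops n n, loopWeight β σ * ((area σ : ℝ) - a) ^ 2 := by
  set E := Real.exp (2 * β) with hE
  have hE1 : 1 ≤ E := Real.one_le_exp (by linarith)
  set C := 6 * E ^ 2 + 2 * (96 * E) ^ 2 with hC
  have hC0 : 0 < C := by positivity
  -- The factor 80000 is 200 * 400, from m ≥ (n + 1) / 200 and half the drift squared, (n + 1) ^ 2 /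
  -- 400. The threshold gives √m ≥ 48 * E, hence a ramp of width l ≥ 1.
  refine ⟨1 / (80000 * C), by positivity, 100 * (⌈(48 * E) ^ 2⌉₊ + 1), ?_⟩
  intro n hn htall a ha0 ha1
  set m := (n + 1) / 100 with hm
  set b := (n + 1) / 2 with hb
  have hm1 : ⌈(48 * E) ^ 2⌉₊ + 1 ≤ m := by omega
  have hmpos : 1 ≤ m := by omega
  have hbn : b ≤ n := by omega
  have hmb : 3 * m ≤ b := by omega
  have hNm : ((n : ℝ) + 1) ≤ 200 * m := by
    have : n + 1 ≤ 200 * m := by omega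
    exact_mod_cast this
  have hmN : 100 * (m : ℝ) ≤ n + 1 := by
    have : 100 * m ≤ n + 1 := by omega
    exact_mod_cast this
  have hm0 : (1 : ℝ) ≤ m := by exact_mod_cast hmpos
  have hmE : 48 * E ≤ Real.sqrt m := by
    apply Real.le_sqrt_of_sq_le
    have h1 := Nat.le_ceil ((48 * E) ^ 2)
    have h2 : ((⌈(48 * E) ^ 2⌉₊ : ℕ) : ℝ) ≤ m := by exact_mod_cast (by omega : _ ≤ m)
    linarith
  set l := ⌊Real.sqrt m / (48 * E)⌋₊ with hl
  have hl1 : 1 ≤ l := by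
    rw [hl, Nat.one_le_floor_iff, one_le_div (by positivity)]
    exact hmE
  have hlle : 48 * E * l ≤ Real.sqrt m := by
    have := Nat.floor_le (show 0 ≤ Real.sqrt m / (48 * E) by positivity)
    rw [le_div_iff₀ (by positivity)] at this
    linarith
  have hlge : Real.sqrt m ≤ 96 * E * l := by
    have h1 := Nat.lt_floor_add_one (Real.sqrt m / (48 * E))
    rw [div_lt_iff₀ (by positivity)] at h1
    have h2 : (1 : ℝ) ≤ l := by exact_mod_cast hl1
    have h3 : ((l : ℝ) + 1) * (48 * E) ≤ (l + l) * (48 * E) := by gcongr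
    linarith
  have hfam := isShiftFamily_bump (n := n) hmpos hbn hmb
  -- Every plateau is one on `core` and zero on `J`; they differ only on `buf`, which holds at most
  -- a fiftieth of the positions, while `J` holds at least half.
  set core : Finset (Fin (n + 1)) := Finset.univ.filter fun i => 2 * m ≤ i.val ∧ i.val + m < b
    with hcore
  set J : Finset (Fin (n + 1)) := Finset.univ.filter fun i => i.val < m ∨ b ≤ i.val with hJ
  set buf : Finset (Fin (n + 1)) := Finset.univ.filter fun i =>
    (m ≤ i.val ∧ i.val < 2 * m) ∨ (b ≤ i.val + m ∧ i.val < b) with hbuf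
  have ccore : core.card = b - 3 * m := by
    rw [hcore, card_filter_fin (fun k => 2 * m ≤ k ∧ k + m < b)]
    have : (Finset.range (n + 1)).filter (fun k => 2 * m ≤ k ∧ k + m < b)
        = Finset.Ico (2 * m) (b - m) := by
      ext k; simp only [Finset.mem_filter, Finset.mem_range, Finset.mem_Ico]; omega
    rw [this, Nat.card_Ico]; omega
  have cJ : J.card = m + (n + 1 - b) := by
    rw [hJ, card_filter_fin (fun k => k < m ∨ b ≤ k)]
    have : (Finset.range (n + 1)).filter (fun k => k < m ∨ b ≤ k)
        = Finset.range m ∪ Finset.Ico b (n + 1) := by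
      ext k
      simp only [Finset.mem_filter, Finset.mem_range, Finset.mem_Ico, Finset.mem_union]; omega
    rw [this, Finset.card_union_of_disjoint, Finset.card_range, Nat.card_Ico]
    rw [Finset.disjoint_left]
    intro k
    simp only [Finset.mem_range, Finset.mem_Ico]; omega
  have cbuf : buf.card = 2 * m := by
    rw [hbuf, card_filter_fin (fun k => (m ≤ k ∧ k < 2 * m) ∨ (b ≤ k + m ∧ k < b))]
    have : (Finset.range (n + 1)).filter (fun k => (m ≤ k ∧ k < 2 * m) ∨ (b ≤ k + m ∧ k < b))
        = Finset.Ico m (2 * m) ∪ Finset.Ico (b - m) b := by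
      ext k
      simp only [Finset.mem_filter, Finset.mem_range, Finset.mem_Ico, Finset.mem_union]; omega
    rw [this, Finset.card_union_of_disjoint, Nat.card_Ico, Nat.card_Ico]
    · omega
    rw [Finset.disjoint_left]
    intro k
    simp only [Finset.mem_Ico]; omega
  have hcne : core.Nonempty := Finset.card_pos.1 (by omega)
  have hJne : J.Nonempty := Finset.card_pos.1 (by omega)
  set gap := minGap core J hcne hJne with hgapdef
  have hone : ∀ s < m, ∀ i ∈ core, bump n m b s i = 1 := by
    intro s hs i hi
    rw [hcore, Finset.mem_filter] at hi
    rw [bump, if_pos (by omega)]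
  have hzero : ∀ s < m, ∀ i ∈ J, bump n m b s i = 0 := by
    intro s hs i hi
    rw [hJ, Finset.mem_filter] at hi
    rw [bump, if_neg (by omega)]
  have hgap : ∀ s < m, ∀ σ, gap (σ + bump n m b s) = gap σ + 1 := fun s hs σ =>
    minGap_add (hone s hs) (hzero s hs) σ
  set Z := ∑ σ ∈ loops n n, loopWeight β σ with hZ
  set T := ∑ σ ∈ loops n n, loopWeight β σ * tall σ with hT
  have hZ0 : 0 ≤ Z := Finset.sum_nonneg fun σ _ => (loopWeight_pos β σ).le
  have hT0 : 0 ≤ T :=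
    Finset.sum_nonneg fun σ _ => mul_nonneg (loopWeight_pos β σ).le (tall_nonneg σ)
  have hNpos : (0 : ℝ) < (n : ℝ) + 1 := by positivity
  have hNT : ((n : ℝ) + 1) * T ≤ Z := by
    refine htall.trans (mul_le_of_le_one_left hZ0 ?_)
    rw [div_le_one (by positivity)]; linarith
  have hmT : (m : ℝ) * T ≤ Z := by
    refine le_trans (mul_le_mul_of_nonneg_right ?_ hT0) hNT
    linarith
  have hpos : Z ≤ 2 * ∑ σ ∈ loops n n, loopWeight β σ * (if 0 ≤ gap σ then 1 else 0) := by
    have h1 := sum_minSet_meets_ge β n J (f := fun σ => if 0 ≤ gap σ then (1 : ℝ) else 0)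
      (fun σ => by split_ifs <;> norm_num) (fun σ hσ => by
        obtain ⟨i, hi⟩ := hσ
        rw [Finset.mem_inter] at hi
        rw [if_pos (minGap_nonneg hi.1 hi.2)])
    have h2 : ((n : ℝ) + 1) / 2 ≤ J.card := by
      have : n + 1 ≤ 2 * J.card := by rw [cJ]; omega
      have : ((n : ℝ) + 1) ≤ 2 * J.card := by exact_mod_cast this
      linarith
    have h3 : ((n : ℝ) + 1) / 2 * Z ≤ J.card * Z := mul_le_mul_of_nonneg_right h2 hZ0
    have h4 := h3.trans h1
    refine le_of_mul_le_mul_left ?_ hNpos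
    linarith
  have hramp := hfam.sum_ramp_ge hβ hmT hgap hpos hl1 hlle
  have hbufmass : ((n : ℝ) + 1) * ∑ σ ∈ loops n n,
      loopWeight β σ * (if minSet σ ⊆ buf then 1 else 0) ≤ 2 * m * Z := by
    have h1 := sum_minSet_subset_le β n buf (f := fun σ => if minSet σ ⊆ buf then (1 : ℝ) else 0)
      (fun σ => by split_ifs <;> norm_num) (fun σ hσ => by simp [hσ])
    rw [cbuf] at h1
    push_cast at h1
    exact h1
  have hcoreN : 0.4 * ((n : ℝ) + 1) ≤ core.card := by
    have : 4 * (n + 1) ≤ 10 * core.card := by rw [ccore]; omega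
    have : 4 * ((n : ℝ) + 1) ≤ 10 * core.card := by exact_mod_cast this
    linarith
  -- A positive gap excludes minima in `core`. Either one lies in `J`, and the area grows by at
  -- least |core|, or all lie in `buf`, which costs at most n + 1 on a fraction of 2 * m / (n + 1)
  -- of the mass. Since 0.4 / 3 - 0.02 ≥ 0.1, the drift is of order n.
  have hdrift : ∀ s < m, (0.1 * ((n : ℝ) + 1)) * Z ≤ ∑ σ ∈ loops n n, loopWeight β σ *
      (ramp l (gap σ) * (((area (σ + bump n m b s) : ℝ) - a) - ((area σ : ℝ) - a))) := by
    intro s hs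
    have hpt : ∀ σ : Loop n, core.card * ramp l (gap σ)
        - (n + 1) * (if minSet σ ⊆ buf then (1 : ℝ) else 0)
        ≤ ramp l (gap σ) * (((area (σ + bump n m b s) : ℝ) - a) - ((area σ : ℝ) - a)) := by
      intro σ
      have hsumge : (core.card : ℤ) ≤ ∑ i, bump n m b s i := by
        calc (core.card : ℤ) = ∑ i ∈ core, bump n m b s i := by
              rw [Finset.sum_congr rfl (hone s hs)]; simp
          _ ≤ _ := Finset.sum_le_sum_of_subset_of_nonneg (Finset.subset_univ _)
              fun i _ _ => by simp only [bump]; split_ifs <;> norm_num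
      obtain ⟨h1, h2⟩ := area_add_sub_ge (σ := σ) (hfam.zero_or_one s hs)
      have hr0 := ramp_nonneg l (gap σ)
      have hr1 := ramp_le_one l (gap σ)
      rw [sub_sub_sub_cancel_right]
      by_cases hb1 : minSet σ ⊆ buf
      · rw [if_pos hb1]
        have h3 : (core.card : ℝ) - (n + 1) ≤ area (σ + bump n m b s) - area σ := by
          have : (core.card : ℤ) - (n + 1) ≤ area (σ + bump n m b s) - area σ := by omega
          exact_mod_cast this
        nlinarith
      · rw [if_neg hb1]
        by_cases hg : gap σ ≤ 0
        · rw [ramp_eq_zero hg]; simp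
        · obtain ⟨i, hi, hib⟩ := Finset.not_subset.1 hb1
          have hic : i ∉ core := fun hic => hg (minGap_nonpos hic hi)
          have hiJ : i ∈ J := by
            simp only [hcore, hJ, hbuf, Finset.mem_filter, Finset.mem_univ, true_and] at hic hib ⊢
            omega
          have h3 : (core.card : ℝ) ≤ area (σ + bump n m b s) - area σ := by
            have := hsumge.trans (h2 ⟨i, hi, hzero s hs i hiJ⟩)
            exact_mod_cast this
          nlinarith
    calc _ ≤ core.card * (∑ σ ∈ loops n n, loopWeight β σ * ramp l (gap σ))
          - (n + 1) * ∑ σ ∈ loops n n, loopWeight β σ * (if minSet σ ⊆ buf then 1 else 0) := by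
          have h1 : 0.4 * ((n : ℝ) + 1) * (Z / 3)
              ≤ core.card * (∑ σ ∈ loops n n, loopWeight β σ * ramp l (gap σ)) :=
            mul_le_mul hcoreN hramp (by positivity) (Nat.cast_nonneg _)
          have h2 : 100 * (m : ℝ) * Z ≤ (n + 1) * Z := mul_le_mul_of_nonneg_right hmN hZ0
          have h3 : 0 ≤ ((n : ℝ) + 1) * Z := by positivity
          linarith
      _ = ∑ σ ∈ loops n n, loopWeight β σ * (core.card * ramp l (gap σ)
          - (n + 1) * (if minSet σ ⊆ buf then (1 : ℝ) else 0)) := by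
          rw [Finset.mul_sum, Finset.mul_sum, ← Finset.sum_sub_distrib]
          exact Finset.sum_congr rfl fun σ _ => by ring
      _ ≤ _ := Finset.sum_le_sum fun σ _ =>
          mul_le_mul_of_nonneg_left (hpt σ) (loopWeight_pos β σ).le
  have hbound : ∀ σ ∈ loops n (n + 1), |(area σ : ℝ) - a| ≤ ((n : ℝ) + 1) ^ 2 := by
    intro σ hσ
    obtain ⟨h1, h2⟩ := area_mem hσ
    have h1' : (0 : ℝ) ≤ area σ := by exact_mod_cast h1
    have h2' : (area σ : ℝ) ≤ (n + 1) * (n + 1) := by exact_mod_cast h2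
    rw [abs_le]; constructor <;> linarith
  have herr : 2 * E * ((n : ℝ) + 1) ^ 2 * T ≤ 0.1 * ((n : ℝ) + 1) / 2 * Z := by
    have h1 := mul_le_mul_of_nonneg_left htall (show 0 ≤ 2 * E * ((n : ℝ) + 1) by positivity)
    calc _ = 2 * E * ((n : ℝ) + 1) * (((n : ℝ) + 1) * T) := by ring
      _ ≤ 2 * E * ((n : ℝ) + 1) * (1 / (40 * E) * Z) := h1
      _ = 2 * ((n : ℝ) + 1) * Z * (E * (1 / (40 * E))) := by ring
      _ = _ := by
        rw [show E * (1 / (40 * E)) = 1 / 40 by field_simp]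
        ring
  have hfinal := hfam.sq_drift_mul_le hβ hmT hgap (l := l)
    (f := fun σ => (area σ : ℝ) - a) (by positivity) hbound hdrift herr
  set V := ∑ σ ∈ loops n n, loopWeight β σ * ((area σ : ℝ) - a) ^ 2 with hV
  have hV0 : 0 ≤ V :=
    Finset.sum_nonneg fun σ _ => mul_nonneg (loopWeight_pos β σ).le (sq_nonneg _)
  have hl0 : (0 : ℝ) < l := by exact_mod_cast hl1
  have hml : ((m : ℝ) * (1 / l)) ^ 2 ≤ m * (96 * E) ^ 2 := by
    have h1 : (m : ℝ) ≤ (96 * E * l) ^ 2 := by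
      rw [← Real.sq_sqrt (Nat.cast_nonneg m)]
      exact pow_le_pow_left₀ (Real.sqrt_nonneg _) hlge 2
    rw [mul_pow, div_pow, one_pow, sq (m : ℝ), mul_assoc]
    refine mul_le_mul_of_nonneg_left ?_ (Nat.cast_nonneg m)
    rw [mul_one_div, div_le_iff₀ (by positivity)]
    calc (m : ℝ) ≤ _ := h1
      _ = _ := by ring
  have h1 : 6 * E ^ 2 * m + 2 * (m * (1 / (l : ℝ))) ^ 2 ≤ m * C := by rw [hC]; linarith
  have h2 := hfinal.trans (mul_le_mul_of_nonneg_right h1 hV0)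
  have h3 : (m : ℝ) * (m * (0.1 * ((n : ℝ) + 1) / 2) ^ 2 * Z) ≤ m * (C * V) := by
    calc _ = (m * (0.1 * ((n : ℝ) + 1)) / 2) ^ 2 * Z := by ring
      _ ≤ _ := h2
      _ = _ := by ring
  have h4 := le_of_mul_le_mul_left h3 (by linarith)
  have h5 : ((n : ℝ) + 1) / 200 * ((0.1 * ((n : ℝ) + 1) / 2) ^ 2 * Z)
      ≤ m * ((0.1 * ((n : ℝ) + 1) / 2) ^ 2 * Z) :=
    mul_le_mul_of_nonneg_right (by linarith) (by positivity)
  rw [div_mul_eq_mul_div, one_mul, div_mul_eq_mul_div, div_le_iff₀ (by positivity)]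
  nlinarith

end AreaVariance

/-! ### Free random walks through generating functions -/

section FreeWalk

open AddMonoidAlgebra

/-- The weight of a step. -/
noncomputable def stepWeight (β : ℝ) (u : ℤ) : ℝ := Real.exp (-β * |(u : ℝ)|)

/-- The generating function of the steps of size at most `L`. -/
noncomputable def stepPoly (β : ℝ) (L : ℕ) : AddMonoidAlgebra ℝ ℤ :=
  ∑ u ∈ Finset.Icc (-(L : ℤ)) L, single u (stepWeight β u)

/-- The total weight of the steps of size at most `L`. -/
noncomputable def stepMass (β : ℝ) (L : ℕ) : ℝ := ∑ u ∈ Finset.Icc (-(L : ℤ)) L, stepWeight β u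

/-- The total weight of the walks of `k` steps that end at `x`. -/
noncomputable def walkMass (β : ℝ) (L k : ℕ) (x : ℤ) : ℝ := (stepPoly β L ^ k).coeff x

/-- The weights may depend on the index, so that one step can be given a different weight in
`sum_sq_step_le`. -/
lemma coeff_prod_sum_single {N : ℕ} (S : Finset ℤ) (a : Fin N → ℤ → ℝ) (x : ℤ) :
    (∏ i, ∑ u ∈ S, (single u (a i u) : AddMonoidAlgebra ℝ ℤ)).coeff x
      = ∑ d ∈ Fintype.piFinset fun _ => S, if ∑ i, d i = x then ∏ i, a i (d i) else 0 := by
  rw [Finset.prod_univ_sum, coeff_sum, Finset.sum_apply']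
  refine Finset.sum_congr rfl fun d _ => ?_
  rw [AddMonoidAlgebra.prod_single, coeff_single, Finsupp.single_apply]

variable {β : ℝ} {L : ℕ}

lemma stepWeight_pos (u : ℤ) : 0 < stepWeight β u := Real.exp_pos _

lemma stepWeight_zero : stepWeight β 0 = 1 := by simp [stepWeight]

lemma stepWeight_neg (u : ℤ) : stepWeight β (-u) = stepWeight β u := by simp [stepWeight]

lemma one_le_stepMass : 1 ≤ stepMass β L := by
  rw [← stepWeight_zero (β := β)]
  exact Finset.single_le_sum (f := stepWeight β) (fun u _ => (stepWeight_pos u).le)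
    (by rw [Finset.mem_Icc]; omega)

lemma walkMass_eq (N : ℕ) (x : ℤ) : walkMass β L N x
    = ∑ d ∈ Fintype.piFinset fun _ : Fin N => Finset.Icc (-(L : ℤ)) L,
      if ∑ i, d i = x then ∏ i, stepWeight β (d i) else 0 := by
  rw [← coeff_prod_sum_single, Finset.prod_const, Finset.card_univ, Fintype.card_fin]
  rfl

lemma walkMass_nonneg (N : ℕ) (x : ℤ) : 0 ≤ walkMass β L N x := by
  rw [walkMass_eq]
  refine Finset.sum_nonneg fun d _ => ?_
  split_ifs
  exacts [Finset.prod_nonneg fun i _ => (stepWeight_pos _).le, le_rfl]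

lemma coeff_sum_single_mul (S : Finset ℤ) (a : ℤ → ℝ) (y : AddMonoidAlgebra ℝ ℤ) (x : ℤ) :
    ((∑ u ∈ S, (single u (a u) : AddMonoidAlgebra ℝ ℤ)) * y).coeff x
      = ∑ u ∈ S, a u * y.coeff (-u + x) := by
  rw [Finset.sum_mul, coeff_sum, Finset.sum_apply']
  exact Finset.sum_congr rfl fun u _ => coeff_single_mul_apply _ _ _ _

lemma walkMass_succ (k : ℕ) (x : ℤ) : walkMass β L (k + 1) x
    = ∑ u ∈ Finset.Icc (-(L : ℤ)) L, stepWeight β u * walkMass β L k (-u + x) := by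
  unfold walkMass
  rw [pow_succ']
  exact coeff_sum_single_mul _ _ _ _

lemma sum_Icc_neg (f : ℤ → ℝ) :
    ∑ u ∈ Finset.Icc (-(L : ℤ)) L, f (-u) = ∑ u ∈ Finset.Icc (-(L : ℤ)) L, f u := by
  refine Finset.sum_nbij' (fun u => -u) (fun u => -u) ?_ ?_ ?_ ?_ ?_ <;>
    simp only [Finset.mem_Icc, neg_neg, implies_true] <;> intro u hu <;> omega

lemma walkMass_neg (k : ℕ) (x : ℤ) : walkMass β L k (-x) = walkMass β L k x := by
  induction k generalizing x with
  | zero =>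
    rw [walkMass_eq, walkMass_eq]
    simp [eq_comm]
  | succ k ih =>
    rw [walkMass_succ, walkMass_succ,
      ← sum_Icc_neg (fun u => stepWeight β u * walkMass β L k (-u + x))]
    refine Finset.sum_congr rfl fun u _ => ?_
    rw [stepWeight_neg, ← ih (- -u + x)]
    congr 2
    ring

/-- Splitting the walk at its midpoint gives a convolution of the symmetric k-step mass with itself,
which is largest at 0, where it is the sum of squares. -/
lemma walkMass_two_mul_le (k : ℕ) (x : ℤ) :
    walkMass β L (k + k) x ≤ walkMass β L (k + k) 0 := by
  have h : ∀ y, walkMass β L (k + k) y = ∑ a ∈ (stepPoly β L ^ k).coeff.support,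
      walkMass β L k a * walkMass β L k (-a + y) := by
    intro y
    unfold walkMass
    rw [pow_add, coeff_mul_apply_left]
    rfl
  have h0 : walkMass β L (k + k) 0
      = ∑ a ∈ (stepPoly β L ^ k).coeff.support, walkMass β L k a ^ 2 := by
    rw [h]
    refine Finset.sum_congr rfl fun a _ => ?_
    rw [add_zero, walkMass_neg, sq]
  rw [h, h0]
  set S := (stepPoly β L ^ k).coeff.support with hS
  have hout : ∀ a, a ∉ S → walkMass β L k a = 0 := fun a ha => Finsupp.notMem_support_iff.1 ha
  have hle : ∑ a ∈ S, walkMass β L k (-a + x) ^ 2 ≤ ∑ a ∈ S, walkMass β L k a ^ 2 := by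
    rw [← Finset.sum_image (f := fun b => walkMass β L k b ^ 2) (g := fun a => -a + x) (s := S)
      (fun a _ b _ hab => by simpa using hab)]
    refine (Finset.sum_le_sum_of_subset_of_nonneg (t := S.image (fun a => -a + x) ∪ S)
      Finset.subset_union_left fun _ _ _ => sq_nonneg _).trans (le_of_eq ?_)
    refine (Finset.sum_subset Finset.subset_union_right fun a _ ha => ?_).symm
    rw [hout a ha]
    norm_num
  have : ∑ a ∈ S, walkMass β L k a * walkMass β L k (-a + x)
      ≤ ∑ a ∈ S, (walkMass β L k a ^ 2 / 2 + walkMass β L k (-a + x) ^ 2 / 2) :=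
    Finset.sum_le_sum fun a _ => by
      nlinarith [sq_nonneg (walkMass β L k a - walkMass β L k (-a + x))]
  rw [Finset.sum_add_distrib, ← Finset.sum_div, ← Finset.sum_div] at this
  linarith

lemma walkMass_zero_le_succ (k : ℕ) : walkMass β L k 0 ≤ walkMass β L (k + 1) 0 := by
  rw [walkMass_succ]
  have := Finset.single_le_sum
    (f := fun u : ℤ => stepWeight β u * walkMass β L k (-u + 0))
    (s := Finset.Icc (-(L : ℤ)) L) (a := 0)
    (fun u _ => mul_nonneg (stepWeight_pos u).le (walkMass_nonneg _ _))
    (by rw [Finset.mem_Icc]; omega)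
  simpa [stepWeight_zero] using this

/-- For odd length one step is split off, and the even case is followed by a zero step of weight
one; this costs the factor `stepMass`. -/
lemma walkMass_le (k : ℕ) (x : ℤ) : walkMass β L k x ≤ stepMass β L * walkMass β L k 0 := by
  rcases Nat.even_or_odd' k with ⟨j, rfl | rfl⟩
  · rw [two_mul]
    exact (walkMass_two_mul_le j x).trans
      (le_mul_of_one_le_left (walkMass_nonneg _ _) one_le_stepMass)
  · refine le_trans ?_ (mul_le_mul_of_nonneg_left (walkMass_zero_le_succ (2 * j))
      (zero_le_one.trans one_le_stepMass))
    rw [walkMass_succ, stepMass, Finset.sum_mul]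
    refine Finset.sum_le_sum fun u _ => mul_le_mul_of_nonneg_left ?_ (stepWeight_pos u).le
    rw [two_mul]
    exact walkMass_two_mul_le _ _

/-- There are 2 * N * L + 1 possible endpoints, each essentially no likelier than 0. Conditioning a
walk to close up therefore costs only a polynomial factor. -/
lemma stepMass_pow_le (N : ℕ) :
    stepMass β L ^ N ≤ (2 * N * L + 1) * (stepMass β L * walkMass β L N 0) := by
  have h1 : stepMass β L ^ N = ∑ d ∈ Fintype.piFinset fun _ : Fin N => Finset.Icc (-(L : ℤ)) L,
      ∏ i, stepWeight β (d i) := by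
    rw [← Finset.prod_univ_sum, Finset.prod_const, Finset.card_univ, Fintype.card_fin]
    rfl
  have h2 : stepMass β L ^ N
      = ∑ x ∈ Finset.Icc (-((N * L : ℕ) : ℤ)) (N * L : ℕ), walkMass β L N x := by
    simp only [walkMass_eq]
    rw [Finset.sum_comm, h1]
    refine Finset.sum_congr rfl fun d hd => ?_
    rw [Finset.sum_ite_eq, if_pos]
    rw [Fintype.mem_piFinset] at hd
    have hb : ∀ i, -(L : ℤ) ≤ d i ∧ d i ≤ L := fun i => Finset.mem_Icc.1 (hd i)
    rw [Finset.mem_Icc]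
    have a1 := Finset.card_nsmul_le_sum Finset.univ d (-(L : ℤ)) fun i _ => (hb i).1
    have a2 := Finset.sum_le_card_nsmul Finset.univ d (L : ℤ) fun i _ => (hb i).2
    simp only [Finset.card_univ, Fintype.card_fin, nsmul_eq_mul] at a1 a2
    push_cast
    constructor <;> linarith
  rw [h2]
  refine (Finset.sum_le_card_nsmul _ _ _ fun x _ => walkMass_le N x).trans (le_of_eq ?_)
  rw [Int.card_Icc, nsmul_eq_mul]
  congr 1
  rw [show ((N * L : ℕ) : ℤ) + 1 - -((N * L : ℕ) : ℤ) = ((2 * N * L + 1 : ℕ) : ℤ) by push_cast; ring,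
    Int.toNat_natCast]
  push_cast
  ring

/-- Step i is reweighted by its square; the other N steps then have to end at minus its value, which
is controlled by the mass of closing up. -/
lemma sum_sq_step_le {N : ℕ} (i : Fin (N + 1)) :
    ∑ d ∈ Fintype.piFinset fun _ : Fin (N + 1) => Finset.Icc (-(L : ℤ)) L,
      (if ∑ j, d j = 0 then (∏ j, stepWeight β (d j)) * (d i : ℝ) ^ 2 else 0)
    ≤ (∑ u ∈ Finset.Icc (-(L : ℤ)) L, (u : ℝ) ^ 2 * stepWeight β u) *
      (stepMass β L * walkMass β L (N + 1) 0) := by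
  have h := coeff_prod_sum_single (Finset.Icc (-(L : ℤ)) L)
    (fun (j : Fin (N + 1)) (u : ℤ) => if j = i then (u : ℝ) ^ 2 * stepWeight β u
      else stepWeight β u) 0
  have e1 : ∀ d : Fin (N + 1) → ℤ, ∏ j, (if j = i then (d j : ℝ) ^ 2 * stepWeight β (d j)
      else stepWeight β (d j)) = (∏ j, stepWeight β (d j)) * (d i : ℝ) ^ 2 := by
    intro d
    rw [← Finset.mul_prod_erase _ _ (Finset.mem_univ i),
      ← Finset.mul_prod_erase _ (fun j => stepWeight β (d j)) (Finset.mem_univ i), if_pos rfl,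
      Finset.prod_congr rfl fun j hj => if_neg (Finset.ne_of_mem_erase hj)]
    ring
  simp only [e1] at h
  rw [← h, ← Finset.mul_prod_erase _ _ (Finset.mem_univ i)]
  have e2 : ∏ j ∈ Finset.univ.erase i, (∑ u ∈ Finset.Icc (-(L : ℤ)) L,
      (single u (if j = i then (u : ℝ) ^ 2 * stepWeight β u else stepWeight β u) :
        AddMonoidAlgebra ℝ ℤ)) = stepPoly β L ^ N := by
    rw [Finset.prod_congr rfl (g := fun _ => stepPoly β L), Finset.prod_const,
      Finset.card_erase_of_mem (Finset.mem_univ i)]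
    · simp
    · intro j hj
      simp only [if_neg (Finset.ne_of_mem_erase hj)]
      rfl
  rw [e2]
  simp only [if_true]
  rw [coeff_sum_single_mul, Finset.sum_mul]
  refine Finset.sum_le_sum fun u _ =>
    mul_le_mul_of_nonneg_left ?_ (mul_nonneg (sq_nonneg _) (stepWeight_pos u).le)
  refine (walkMass_le N _).trans (mul_le_mul_of_nonneg_left (walkMass_zero_le_succ N) ?_)
  exact zero_le_one.trans one_le_stepMass

lemma summable_pow_mul_exp_abs (k : ℕ) {r : ℝ} (hr : 0 < r) :
    Summable fun u : ℤ => (u : ℝ) ^ (2 * k) * Real.exp (-r * |(u : ℝ)|) := by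
  have h := Real.summable_pow_mul_exp_neg_nat_mul (2 * k) hr
  refine Summable.of_nat_of_neg ?_ ?_
  · simpa using h
  · simpa [pow_mul] using h

lemma exists_sum_pow_mul_exp_le (k : ℕ) {r : ℝ} (hr : 0 < r) : ∃ C : ℝ, 0 < C ∧ ∀ L : ℕ,
    ∑ u ∈ Finset.Icc (-(L : ℤ)) L, (u : ℝ) ^ (2 * k) * Real.exp (-r * |(u : ℝ)|) ≤ C := by
  have h := summable_pow_mul_exp_abs k hr
  refine ⟨∑' u : ℤ, (u : ℝ) ^ (2 * k) * Real.exp (-r * |(u : ℝ)|) + 1, ?_, fun L => ?_⟩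
  · have : 0 ≤ ∑' u : ℤ, (u : ℝ) ^ (2 * k) * Real.exp (-r * |(u : ℝ)|) :=
      tsum_nonneg fun u => by rw [pow_mul]; positivity
    linarith
  · have := h.sum_le_tsum (Finset.Icc (-(L : ℤ)) L) fun u _ => by
      rw [pow_mul]; positivity
    linarith

lemma exp_le_quadratic (y : ℝ) : Real.exp y ≤ 1 + y + y ^ 2 * Real.exp |y| := by
  have h := Complex.norm_exp_sub_sum_le_norm_mul_exp (y : ℂ) 2
  have e : Complex.exp y - ∑ m ∈ Finset.range 2, (y : ℂ) ^ m / (m.factorial : ℂ)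
      = ((Real.exp y - (1 + y) : ℝ) : ℂ) := by
    push_cast
    simp [Finset.sum_range_succ]
  rw [e, Complex.norm_real, Complex.norm_real, Real.norm_eq_abs, Real.norm_eq_abs, sq_abs] at h
  linarith [le_abs_self (Real.exp y - (1 + y))]

/-- The linear term of the exponential cancels by symmetry, and half of the exponential decay of the
weight pays for the factor exp |t * u| in the remainder. -/
lemma tilted_stepMass_le {C : ℝ}
    (hC : ∑ u ∈ Finset.Icc (-(L : ℤ)) L, (u : ℝ) ^ (2 * 1) * Real.exp (-(β / 2) * |(u : ℝ)|) ≤ C)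
    (hC0 : 0 ≤ C) {t : ℝ} (ht : |t| ≤ β / 2) :
    ∑ u ∈ Finset.Icc (-(L : ℤ)) L, stepWeight β u * Real.exp (t * u)
      ≤ stepMass β L * Real.exp (C * t ^ 2) := by
  have hodd : ∑ u ∈ Finset.Icc (-(L : ℤ)) L, stepWeight β u * (t * u) = 0 := by
    have := sum_Icc_neg (L := L) fun u : ℤ => stepWeight β u * (t * u)
    simp only [stepWeight_neg, Int.cast_neg, mul_neg, Finset.sum_neg_distrib] at this
    linarith
  have hquad : ∑ u ∈ Finset.Icc (-(L : ℤ)) L,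
      stepWeight β u * ((t * u) ^ 2 * Real.exp |t * u|) ≤ C * t ^ 2 := by
    calc _ ≤ ∑ u ∈ Finset.Icc (-(L : ℤ)) L,
          ((u : ℝ) ^ (2 * 1) * Real.exp (-(β / 2) * |(u : ℝ)|)) * t ^ 2 := by
          refine Finset.sum_le_sum fun u _ => ?_
          have h1 : stepWeight β u * Real.exp |t * u| ≤ Real.exp (-(β / 2) * |(u : ℝ)|) := by
            unfold stepWeight
            rw [← Real.exp_add, abs_mul]
            apply Real.exp_le_exp.2
            have := mul_le_mul_of_nonneg_right ht (abs_nonneg (u : ℝ))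
            linarith
          calc _ = (t * u) ^ 2 * (stepWeight β u * Real.exp |t * u|) := by ring
            _ ≤ (t * u) ^ 2 * Real.exp (-(β / 2) * |(u : ℝ)|) :=
              mul_le_mul_of_nonneg_left h1 (sq_nonneg _)
            _ = _ := by ring
      _ ≤ _ := by
          rw [← Finset.sum_mul]
          exact mul_le_mul_of_nonneg_right hC (sq_nonneg t)
  have hle : ∑ u ∈ Finset.Icc (-(L : ℤ)) L, stepWeight β u * Real.exp (t * u)
      ≤ stepMass β L + C * t ^ 2 := by
    calc _ ≤ ∑ u ∈ Finset.Icc (-(L : ℤ)) L, (stepWeight β u + stepWeight β u * (t * u)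
          + stepWeight β u * ((t * u) ^ 2 * Real.exp |t * u|)) := by
          refine Finset.sum_le_sum fun u _ => ?_
          have := mul_le_mul_of_nonneg_left (exp_le_quadratic (t * u)) (stepWeight_pos (β := β) u).le
          linarith
      _ ≤ _ := by
          rw [Finset.sum_add_distrib, Finset.sum_add_distrib, hodd, add_zero]
          exact add_le_add_right hquad _
  have h1 := Real.add_one_le_exp (C * t ^ 2)
  have h2 := one_le_stepMass (β := β) (L := L)
  have h3 : 0 ≤ C * t ^ 2 := by positivity
  nlinarith

/-- The walk with steps `d` after `k` steps. -/
def walkAt {n : ℕ} (d : Fin (n + 1) → ℤ) (k : Fin (n + 1)) : ℤ :=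
  ∑ i, if i.val < k.val then d i else 0

lemma sum_exp_walkAt_le {n : ℕ} {C : ℝ}
    (hC : ∑ u ∈ Finset.Icc (-(L : ℤ)) L, (u : ℝ) ^ (2 * 1) * Real.exp (-(β / 2) * |(u : ℝ)|) ≤ C)
    (hC0 : 0 ≤ C) {t : ℝ} (ht : |t| ≤ β / 2) (k : Fin (n + 1)) :
    ∑ d ∈ Fintype.piFinset fun _ : Fin (n + 1) => Finset.Icc (-(L : ℤ)) L,
      (∏ i, stepWeight β (d i)) * Real.exp (t * walkAt d k)
    ≤ stepMass β L ^ (n + 1) * Real.exp (C * t ^ 2 * (n + 1)) := by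
  have e : ∀ d : Fin (n + 1) → ℤ, (∏ i, stepWeight β (d i)) * Real.exp (t * walkAt d k)
      = ∏ i, stepWeight β (d i) * Real.exp ((if i.val < k.val then t else 0) * d i) := by
    intro d
    rw [Finset.prod_mul_distrib, ← Real.exp_sum]
    congr 2
    unfold walkAt
    push_cast
    rw [Finset.mul_sum]
    refine Finset.sum_congr rfl fun i _ => ?_
    split_ifs <;> simp
  simp only [e]
  rw [← Finset.prod_univ_sum (fun _ => Finset.Icc (-(L : ℤ)) L)
    (fun (i : Fin (n + 1)) (u : ℤ) =>
      stepWeight β u * Real.exp ((if i.val < k.val then t else 0) * u))]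
  calc _ ≤ ∏ _i : Fin (n + 1), stepMass β L * Real.exp (C * t ^ 2) := by
        refine Finset.prod_le_prod (fun i _ => Finset.sum_nonneg fun u _ =>
          mul_nonneg (stepWeight_pos u).le (Real.exp_pos _).le) fun i _ => ?_
        split_ifs
        · exact tilted_stepMass_le hC hC0 ht
        · simp only [zero_mul, Real.exp_zero, mul_one]
          exact le_mul_of_one_le_right (zero_le_one.trans one_le_stepMass)
            (Real.one_le_exp (by positivity))
    _ = _ := by
        rw [Finset.prod_const, Finset.card_univ, Fintype.card_fin, mul_pow, ← Real.exp_nat_mul]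
        congr 2
        push_cast
        ring

end FreeWalk

/-! ### Loops against closed walks; negligibility of tall loops -/

section Comparison

variable {n : ℕ} {β : ℝ}

/-- The steps of a loop, as a closed walk with steps of size at most `n + 1`. -/
noncomputable def closedWalks (n : ℕ) : Finset (Fin (n + 1) → ℤ) :=
  (Fintype.piFinset fun _ => Finset.Icc (-((n + 1 : ℕ) : ℤ)) (n + 1 : ℕ)).filter
    fun d => ∑ i, d i = 0

lemma sum_step (σ : Loop n) : ∑ i, step σ i = 0 := by
  simp only [step, Finset.sum_sub_distrib]
  rw [show ∑ i, σ (i + 1) = ∑ i, σ i from Equiv.sum_comp (Equiv.addRight 1) σ, sub_self]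

lemma loop_ext_step {σ τ : Loop n} (h0 : σ 0 = τ 0) (h : ∀ i, step σ i = step τ i) : σ = τ := by
  funext i
  induction i using Fin.induction with
  | zero => exact h0
  | succ i ih =>
    have := h i.castSucc
    simp only [step, Fin.coeSucc_eq_succ] at this
    omega

lemma loopWeight_eq_prod (σ : Loop n) : loopWeight β σ = ∏ i, stepWeight β (step σ i) := by
  unfold loopWeight loopEnergy stepWeight
  rw [← Real.exp_sum]
  congr 1
  push_cast
  rw [Finset.mul_sum]

lemma step_mem_closedWalks {σ : Loop n} (hσ : σ ∈ loops n (n + 1)) :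
    (fun i => step σ i) ∈ closedWalks n := by
  rw [closedWalks, Finset.mem_filter, Fintype.mem_piFinset]
  refine ⟨fun i => ?_, sum_step σ⟩
  have h1 := (mem_loops.1 hσ).2 (i + 1) i
  have h2 := (mem_loops.1 hσ).2 i (i + 1)
  rw [Finset.mem_Icc]
  simp only [step]
  omega

lemma walkAt_zero (d : Fin (n + 1) → ℤ) : walkAt d 0 = 0 := by simp [walkAt]

lemma step_walkAt {d : Fin (n + 1) → ℤ} (hd : ∑ i, d i = 0) (i : Fin (n + 1)) :
    step (walkAt d) i = d i := by
  unfold step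
  by_cases h : i = Fin.last n
  · rw [h, Fin.last_add_one, walkAt_zero, zero_sub, neg_eq_iff_add_eq_zero, ← hd]
    unfold walkAt
    rw [Fin.sum_univ_castSucc, Fin.sum_univ_castSucc]
    simp
  · unfold walkAt
    rw [← Finset.sum_sub_distrib, Finset.sum_eq_single i]
    · rw [Fin.val_add_one, if_neg h]
      simp
    · intro j _ hj
      have : j.val ≠ i.val := fun h => hj (Fin.ext h)
      rw [Fin.val_add_one, if_neg h]
      split_ifs <;> omega
    · simp

lemma walkAt_step {σ : Loop n} (h0 : σ 0 = 0) : walkAt (fun i => step σ i) = σ :=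
  loop_ext_step (by rw [walkAt_zero, h0]) (step_walkAt (sum_step σ))

lemma sum_loops_le_sum_closedWalks {K : ℕ} (hK : K ≤ n + 1) {f : Loop n → ℝ}
    {g : (Fin (n + 1) → ℤ) → ℝ} (hg : ∀ d, 0 ≤ g d)
    (hfg : ∀ σ ∈ loops n K, f σ ≤ g fun i => step σ i) :
    ∑ σ ∈ loops n K, loopWeight β σ * f σ
      ≤ ∑ d ∈ closedWalks n, (∏ i, stepWeight β (d i)) * g d := by
  have hsub : (loops n K).image (fun σ i => step σ i) ⊆ closedWalks n := by
    intro d hd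
    obtain ⟨σ, hσ, rfl⟩ := Finset.mem_image.1 hd
    refine step_mem_closedWalks ?_
    rw [mem_loops] at hσ ⊢
    exact ⟨hσ.1, fun i j => (hσ.2 i j).trans (by exact_mod_cast hK)⟩
  refine le_trans ?_ (Finset.sum_le_sum_of_subset_of_nonneg hsub fun d _ _ =>
    mul_nonneg (Finset.prod_nonneg fun i _ => (stepWeight_pos _).le) (hg d))
  rw [Finset.sum_image]
  · refine Finset.sum_le_sum fun σ hσ => ?_
    rw [← loopWeight_eq_prod]
    exact mul_le_mul_of_nonneg_left (hfg σ hσ) (loopWeight_pos β σ).le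
  · intro σ hσ τ hτ h
    exact loop_ext_step ((mem_loops.1 hσ).1.trans (mem_loops.1 hτ).1.symm) (congrFun h)

/-- The total weight of the closed walks. -/
noncomputable def freeMass (β : ℝ) (n : ℕ) : ℝ := walkMass β (n + 1) (n + 1) 0

lemma freeMass_eq : freeMass β n = ∑ d ∈ closedWalks n, ∏ i, stepWeight β (d i) := by
  rw [freeMass, walkMass_eq, closedWalks, Finset.sum_filter]

lemma freeMass_nonneg : 0 ≤ freeMass β n := walkMass_nonneg _ _

lemma sum_loops_le_freeMass : ∑ σ ∈ loops n (n + 1), loopWeight β σ ≤ freeMass β n := by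
  have := sum_loops_le_sum_closedWalks (β := β) (n := n) le_rfl (f := fun _ => 1) (g := fun _ => 1)
    (fun _ => zero_le_one) fun _ _ => le_rfl
  simpa [freeMass_eq] using this

lemma sum_sqSteps_le {C : ℝ}
    (hC : ∑ u ∈ Finset.Icc (-((n + 1 : ℕ) : ℤ)) (n + 1 : ℕ), (u : ℝ) ^ 2 * stepWeight β u ≤ C) :
    ∑ σ ∈ loops n (n + 1), loopWeight β σ * (sqSteps σ : ℝ)
      ≤ (n + 1) * (C * (stepMass β (n + 1) * freeMass β n)) := by
  refine (sum_loops_le_sum_closedWalks (β := β) le_rfl (g := fun d => ∑ i, (d i : ℝ) ^ 2)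
    (fun d => Finset.sum_nonneg fun i _ => sq_nonneg _) fun σ _ => ?_).trans ?_
  · unfold sqSteps
    push_cast
    exact le_rfl
  · simp only [Finset.mul_sum]
    rw [Finset.sum_comm]
    refine (Finset.sum_le_card_nsmul _ _ (C * (stepMass β (n + 1) * freeMass β n))
      fun i _ => ?_).trans (le_of_eq ?_)
    · have h := sum_sq_step_le (β := β) (L := n + 1) (N := n) i
      rw [closedWalks, Finset.sum_filter]
      exact h.trans (mul_le_mul_of_nonneg_right hC
        (mul_nonneg (zero_le_one.trans one_le_stepMass) freeMass_nonneg))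
    · simp

/-- The weight of the closed walks that reach a distance of at least `n / 2`. -/
noncomputable def tailMass (β : ℝ) (n : ℕ) : ℝ :=
  ∑ d ∈ closedWalks n, (∏ i, stepWeight β (d i)) *
    if ∃ k, (n : ℤ) ≤ 2 * |walkAt d k| then 1 else 0

lemma exists_abs_ge {σ : Loop n} {i j : Fin (n + 1)} (h : (n : ℤ) ≤ σ i - σ j) :
    ∃ k, (n : ℤ) ≤ 2 * |σ k| := by
  by_contra! hc
  have h1 := hc i
  have h2 := hc j
  have h3 := le_abs_self (σ i)
  have h4 := neg_abs_le (σ j)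
  omega

lemma sum_tall_le : ∑ σ ∈ loops n n, loopWeight β σ * tall σ ≤ tailMass β n := by
  refine sum_loops_le_sum_closedWalks (Nat.le_succ n) (fun d => by split_ifs <;> norm_num)
    fun σ hσ => ?_
  rw [walkAt_step (mem_loops.1 hσ).1]
  unfold tall
  by_cases h : ∃ i j, (n : ℤ) ≤ σ i - σ j
  · obtain ⟨i, j, hij⟩ := h
    rw [if_pos ⟨i, j, hij⟩, if_pos (exists_abs_ge hij)]
  · rw [if_neg h]
    split_ifs <;> norm_num

/-- A closed walk that always stays below distance n / 2 from the origin has height differences at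
most n. -/
lemma freeMass_le : freeMass β n ≤ ∑ σ ∈ loops n n, loopWeight β σ + tailMass β n := by
  rw [freeMass_eq, ← Finset.sum_filter_add_sum_filter_not _ (fun d => walkAt d ∈ loops n n)]
  refine add_le_add ?_ ?_
  · calc _ = ∑ d ∈ (closedWalks n).filter (fun d => walkAt d ∈ loops n n),
          loopWeight β (walkAt d) := by
          refine Finset.sum_congr rfl fun d hd => ?_
          rw [Finset.mem_filter, closedWalks, Finset.mem_filter] at hd
          simp only [loopWeight_eq_prod, step_walkAt hd.1.2]
      _ = ∑ σ ∈ ((closedWalks n).filter (fun d => walkAt d ∈ loops n n)).image walkAt,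
          loopWeight β σ := by
          rw [Finset.sum_image]
          intro d hd d' hd' h
          rw [Finset.mem_coe, Finset.mem_filter, closedWalks, Finset.mem_filter] at hd hd'
          funext i
          rw [← step_walkAt hd.1.2, ← step_walkAt hd'.1.2, h]
      _ ≤ _ := by
          refine Finset.sum_le_sum_of_subset_of_nonneg ?_ fun σ _ _ => (loopWeight_pos β σ).le
          intro σ hσ
          obtain ⟨d, hd, rfl⟩ := Finset.mem_image.1 hσ
          exact (Finset.mem_filter.1 hd).2
  · unfold tailMass
    rw [Finset.sum_filter]
    refine Finset.sum_le_sum fun d _ => ?_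
    have hp : 0 ≤ ∏ i, stepWeight β (d i) := Finset.prod_nonneg fun i _ => (stepWeight_pos _).le
    by_cases h : walkAt d ∈ loops n n
    · rw [if_neg (not_not.2 h)]
      exact mul_nonneg hp (by split_ifs <;> norm_num)
    · rw [if_pos h, if_pos, mul_one]
      by_contra! hc
      apply h
      rw [mem_loops]
      refine ⟨walkAt_zero d, fun i j => ?_⟩
      have h1 := hc i
      have h2 := hc j
      have h3 := le_abs_self (walkAt d i)
      have h4 := neg_abs_le (walkAt d j)
      omega

/-- A Chernoff bound in both directions and a union over the times, after dropping the condition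
that the walk closes up. -/
lemma tailMass_le {C : ℝ} (hC : ∑ u ∈ Finset.Icc (-((n + 1 : ℕ) : ℤ)) (n + 1 : ℕ),
      (u : ℝ) ^ (2 * 1) * Real.exp (-(β / 2) * |(u : ℝ)|) ≤ C)
    (hC0 : 0 ≤ C) {t : ℝ} (ht0 : 0 ≤ t) (ht : t ≤ β / 2) :
    tailMass β n ≤ (n + 1) * (2 * (stepMass β (n + 1) ^ (n + 1) *
      Real.exp (C * t ^ 2 * (n + 1))) * Real.exp (-(t * n / 2))) := by
  set B := Fintype.piFinset fun _ : Fin (n + 1) => Finset.Icc (-((n + 1 : ℕ) : ℤ)) (n + 1 : ℕ)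
  have hpt : ∀ d : Fin (n + 1) → ℤ, (if ∃ k, (n : ℤ) ≤ 2 * |walkAt d k| then (1 : ℝ) else 0)
      ≤ ∑ k, (Real.exp (t * walkAt d k) + Real.exp (-t * walkAt d k)) * Real.exp (-(t * n / 2)) := by
    intro d
    have hnn : ∀ k ∈ Finset.univ, 0 ≤
        (Real.exp (t * walkAt d k) + Real.exp (-t * walkAt d k)) * Real.exp (-(t * n / 2)) :=
      fun k _ => by positivity
    split_ifs with h
    · obtain ⟨k, hk⟩ := h
      refine le_trans ?_ (Finset.single_le_sum hnn (Finset.mem_univ k))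
      have hk' : (n : ℝ) ≤ 2 * |(walkAt d k : ℝ)| := by exact_mod_cast hk
      have h1 : Real.exp (t * n / 2)
          ≤ Real.exp (t * walkAt d k) + Real.exp (-t * walkAt d k) := by
        have h2 : t * n / 2 ≤ t * |(walkAt d k : ℝ)| := by nlinarith
        rcases abs_cases (walkAt d k : ℝ) with ⟨h3, -⟩ | ⟨h3, -⟩
        · rw [h3] at h2
          exact (Real.exp_le_exp.2 h2).trans (le_add_of_nonneg_right (Real.exp_pos _).le)
        · rw [h3] at h2
          exact (Real.exp_le_exp.2 (h2.trans (by linarith))).trans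
            (le_add_of_nonneg_left (Real.exp_pos _).le)
      calc (1 : ℝ) = Real.exp (t * n / 2) * Real.exp (-(t * n / 2)) := by
            rw [← Real.exp_add, add_neg_cancel, Real.exp_zero]
        _ ≤ _ := by gcongr
    · exact Finset.sum_nonneg hnn
  have hprod : ∀ d : Fin (n + 1) → ℤ, 0 ≤ ∏ i, stepWeight β (d i) :=
    fun d => Finset.prod_nonneg fun i _ => (stepWeight_pos _).le
  calc tailMass β n ≤ ∑ d ∈ B, (∏ i, stepWeight β (d i)) *
        ∑ k, (Real.exp (t * walkAt d k) + Real.exp (-t * walkAt d k)) * Real.exp (-(t * n / 2)) := by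
        refine (Finset.sum_le_sum fun d _ => mul_le_mul_of_nonneg_left (hpt d) (hprod d)).trans ?_
        exact Finset.sum_le_sum_of_subset_of_nonneg (Finset.filter_subset _ _) fun d _ _ =>
          mul_nonneg (hprod d) (Finset.sum_nonneg fun k _ => by positivity)
    _ = ∑ k, ((∑ d ∈ B, (∏ i, stepWeight β (d i)) * Real.exp (t * walkAt d k))
          + ∑ d ∈ B, (∏ i, stepWeight β (d i)) * Real.exp (-t * walkAt d k))
          * Real.exp (-(t * n / 2)) := by
        simp only [Finset.mul_sum]
        rw [Finset.sum_comm]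
        refine Finset.sum_congr rfl fun k _ => ?_
        rw [← Finset.sum_add_distrib, Finset.sum_mul]
        exact Finset.sum_congr rfl fun d _ => by ring
    _ ≤ ∑ _k : Fin (n + 1), (2 * (stepMass β (n + 1) ^ (n + 1) *
          Real.exp (C * t ^ 2 * (n + 1))) * Real.exp (-(t * n / 2))) := by
        refine Finset.sum_le_sum fun k _ =>
          mul_le_mul_of_nonneg_right ?_ (Real.exp_pos _).le
        have h1 := sum_exp_walkAt_le (L := n + 1) hC hC0 (t := t) (by rwa [abs_of_nonneg ht0]) k
        have h2 := sum_exp_walkAt_le (L := n + 1) hC hC0 (t := -t)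
          (by rwa [abs_neg, abs_of_nonneg ht0]) k
        rw [neg_sq] at h2
        linarith
    _ = _ := by simp

lemma exists_stepMass_le (hβ : 0 < β) : ∃ q : ℝ, 0 < q ∧ ∀ L, stepMass β L ≤ q := by
  obtain ⟨q, hq, h⟩ := exists_sum_pow_mul_exp_le 0 hβ
  refine ⟨q, hq, fun L => ?_⟩
  simpa [stepMass, stepWeight] using h L

/-- A closed walk of `n` steps is unlikely to reach a distance of order `n`. -/
lemma eventually_tailMass_le (hβ : 0 < β) {δ : ℝ} (hδ : 0 < δ) :
    ∃ n₀ : ℕ, ∀ n ≥ n₀, ((n : ℝ) + 1) * tailMass β n ≤ δ * freeMass β n := by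
  obtain ⟨C, hC0, hC⟩ := exists_sum_pow_mul_exp_le 1 (half_pos hβ)
  obtain ⟨q, hq0, hq⟩ := exists_stepMass_le hβ
  -- Small enough that C * t ^ 2 * (n + 1) ≤ t * n / 4, leaving the decay exp (-t * n / 4), which
  -- beats the fourth power of n + 1 collected from the union, closing up and the claim itself.
  set t := min (β / 2) (1 / (8 * C)) with ht
  have ht0 : 0 < t := lt_min (by linarith) (by positivity)
  have htC : C * t ≤ 1 / 8 := by
    have := min_le_right (β / 2) (1 / (8 * C))
    rw [← ht, le_div_iff₀ (by positivity)] at this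
    linarith
  have hlim := tendsto_pow_const_mul_const_pow_of_abs_lt_one 4 (r := Real.exp (-(t / 4)))
    (by rw [abs_of_pos (Real.exp_pos _), Real.exp_lt_one_iff]; linarith)
  have hev := hlim.eventually (gt_mem_nhds (show 0 < δ / (2 * 3 * 16 * q) by positivity))
  obtain ⟨n₀, hn₀⟩ := Filter.eventually_atTop.1 hev
  refine ⟨max n₀ 1, fun n hn => ?_⟩
  have hn1 : 1 ≤ n := (le_max_right _ _).trans hn
  have hx := (hn₀ n ((le_max_left _ _).trans hn)).le
  have hn1' : (1 : ℝ) ≤ n := by exact_mod_cast hn1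
  have hF := freeMass_nonneg (β := β) (n := n)
  have h1 := tailMass_le (hC (n + 1)) hC0.le ht0.le (min_le_left _ _)
  have h2 := stepMass_pow_le (β := β) (L := n + 1) (n + 1)
  have h3 : stepMass β (n + 1) ^ (n + 1) ≤ 3 * ((n : ℝ) + 1) ^ 2 * (q * freeMass β n) := by
    refine h2.trans ?_
    push_cast
    refine mul_le_mul ?_ (mul_le_mul_of_nonneg_right (hq _) hF)
      (mul_nonneg (zero_le_one.trans one_le_stepMass) hF) (by positivity)
    nlinarith
  have h4 : Real.exp (C * t ^ 2 * (n + 1)) * Real.exp (-(t * n / 2))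
      ≤ Real.exp (-(t / 4)) ^ n := by
    rw [← Real.exp_add, ← Real.exp_nat_mul]
    apply Real.exp_le_exp.2
    have h5 : C * t ^ 2 * (n + 1) ≤ 1 / 8 * (t * (n + 1)) := by
      calc _ = (C * t) * (t * (n + 1)) := by ring
        _ ≤ _ := mul_le_mul_of_nonneg_right htC (by positivity)
    nlinarith
  have hq1 : 0 ≤ q * freeMass β n := by positivity
  have hn2 : ((n : ℝ) + 1) ^ 4 ≤ 16 * n ^ 4 := by
    calc ((n : ℝ) + 1) ^ 4 ≤ (2 * n) ^ 4 := pow_le_pow_left₀ (by positivity) (by linarith) 4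
      _ = _ := by ring
  calc ((n : ℝ) + 1) * tailMass β n
      ≤ (n + 1) * ((n + 1) * (2 * (stepMass β (n + 1) ^ (n + 1) *
        Real.exp (C * t ^ 2 * (n + 1))) * Real.exp (-(t * n / 2)))) := by gcongr
    _ = 2 * (n + 1) ^ 2 * stepMass β (n + 1) ^ (n + 1) *
        (Real.exp (C * t ^ 2 * (n + 1)) * Real.exp (-(t * n / 2))) := by ring
    _ ≤ 2 * (n + 1) ^ 2 * (3 * ((n : ℝ) + 1) ^ 2 * (q * freeMass β n)) *
        Real.exp (-(t / 4)) ^ n := by gcongr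
    _ = ((n : ℝ) + 1) ^ 4 * (2 * 3 * (q * freeMass β n) * Real.exp (-(t / 4)) ^ n) := by ring
    _ ≤ 16 * n ^ 4 * (2 * 3 * (q * freeMass β n) * Real.exp (-(t / 4)) ^ n) := by gcongr
    _ = (2 * 3 * 16 * q) * (n ^ 4 * Real.exp (-(t / 4)) ^ n) * freeMass β n := by ring
    _ ≤ (2 * 3 * 16 * q) * (δ / (2 * 3 * 16 * q)) * freeMass β n := by gcongr
    _ = _ := by field_simp

/-- Up to a constant, the loops with height differences at most `n` carry the mass of all closed
walks, and those of maximal height are negligible. -/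
lemma exists_freeMass_bounds (hβ : 0 < β) {δ : ℝ} (hδ : 0 < δ) :
    ∃ n₀ : ℕ, ∀ n ≥ n₀,
      freeMass β n ≤ 2 * ∑ σ ∈ loops n n, loopWeight β σ ∧
      ((n : ℝ) + 1) * ∑ σ ∈ loops n n, loopWeight β σ * tall σ
        ≤ δ * ∑ σ ∈ loops n n, loopWeight β σ := by
  obtain ⟨n₀, h⟩ := eventually_tailMass_le hβ (lt_min (half_pos hδ) (by norm_num : (0 : ℝ) < 1 / 2))
  refine ⟨n₀, fun n hn => ?_⟩
  have h1 := h n hn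
  have h2 := freeMass_le (β := β) (n := n)
  have h3 := sum_tall_le (β := β) (n := n)
  have hF := freeMass_nonneg (β := β) (n := n)
  have hT : 0 ≤ tailMass β n := Finset.sum_nonneg fun d _ =>
    mul_nonneg (Finset.prod_nonneg fun i _ => (stepWeight_pos _).le) (by split_ifs <;> norm_num)
  have hmin1 := mul_le_mul_of_nonneg_right (min_le_left (δ / 2) (1 / 2)) hF
  have hmin2 := mul_le_mul_of_nonneg_right (min_le_right (δ / 2) (1 / 2)) hF
  have hn0 : (0 : ℝ) ≤ n := Nat.cast_nonneg n
  have h4 : freeMass β n ≤ 2 * ∑ σ ∈ loops n n, loopWeight β σ := by nlinarith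
  refine ⟨h4, ?_⟩
  have h5 : ((n : ℝ) + 1) * ∑ σ ∈ loops n n, loopWeight β σ * tall σ
      ≤ (n + 1) * tailMass β n := by gcongr
  nlinarith

end Comparison

/-! ### Equilibrium estimates for the Gibbs distribution and the conclusion -/

section Final

lemma sum_gibbs_mul {β : ℝ} {n : ℕ} (G : Loop n → ℝ) :
    ∑ η : Config n, gibbs β n η * G (toLoop η)
      = (∑ σ ∈ (loops n n).filter (0 ∈ minSet ·), loopWeight β σ * G σ) / partitionFunction β n := by
  rw [← sum_weight_eq, Finset.sum_div]
  exact Finset.sum_congr rfl fun η _ => by rw [gibbs]; ring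

lemma partitionFunction_eq {β : ℝ} {n : ℕ} :
    partitionFunction β n = ∑ σ ∈ (loops n n).filter (0 ∈ minSet ·), loopWeight β σ := by
  have := sum_weight_eq (n := n) β fun _ => 1
  simpa [partitionFunction] using this

lemma sum_loops_le_mul_partitionFunction {β : ℝ} {n : ℕ} :
    ∑ σ ∈ loops n n, loopWeight β σ ≤ (n + 1) * partitionFunction β n := by
  have := sum_loops_le_mul_sum_excursions (n := n) β (G := fun _ => 1) (fun _ _ => rfl)
    fun _ => zero_le_one
  simpa [partitionFunction_eq] using this

lemma mul_partitionFunction_le {β : ℝ} (hβ : 0 < β) {n : ℕ}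
    (h : freeMass β n ≤ 2 * ∑ σ ∈ loops n n, loopWeight β σ) :
    (n + 1) * partitionFunction β n
      ≤ 2 * Real.exp (2 * β) * ∑ σ ∈ loops n n, loopWeight β σ := by
  have h1 := mul_sum_excursions_le (n := n) hβ (G := fun _ => 1) (fun _ _ => rfl)
    (fun _ => zero_le_one) fun _ _ => le_rfl
  simp only [mul_one] at h1
  rw [← partitionFunction_eq] at h1
  have h2 := mul_le_mul_of_nonneg_left ((sum_loops_le_freeMass (β := β)).trans h)
    (Real.exp_pos (2 * β)).le
  linarith

/-- Under the Gibbs distribution the total height has variance of order at least `n ^ 3`. -/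
lemma exists_variance_totalHeight_ge {β : ℝ} (hβ : 0 < β) : ∃ c : ℝ, 0 < c ∧ ∃ n₀ : ℕ, ∀ n ≥ n₀,
    c * (n : ℝ) ^ 3 ≤ ∑ η : Config n, gibbs β n η *
      (totalHeight η - ∑ ξ : Config n, gibbs β n ξ * totalHeight ξ) ^ 2 := by
  obtain ⟨c, hc, n₁, h₁⟩ := area_variance_ge hβ
  obtain ⟨n₂, h₂⟩ := exists_freeMass_bounds hβ
    (show 0 < 1 / (40 * Real.exp (2 * β)) by positivity)
  refine ⟨c / (2 * Real.exp (2 * β)), by positivity, max n₁ n₂, fun n hn => ?_⟩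
  obtain ⟨hfree, htall⟩ := h₂ n ((le_max_right _ _).trans hn)
  set a := ∑ ξ : Config n, gibbs β n ξ * totalHeight ξ with ha
  have hTH : ∀ η : Config n, 0 ≤ totalHeight η ∧ totalHeight η ≤ ((n : ℝ) + 1) ^ 2 := by
    intro η
    refine ⟨Finset.sum_nonneg fun i _ => Nat.cast_nonneg _, ?_⟩
    refine (Finset.sum_le_card_nsmul _ _ (n : ℝ) fun i _ => ?_).trans ?_
    · have := (η i).isLt
      exact_mod_cast (by omega : (η i).val ≤ n)
    · simp only [Finset.card_univ, Fintype.card_fin, nsmul_eq_mul]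
      have : (0 : ℝ) ≤ n := Nat.cast_nonneg n
      nlinarith
  have ha0 : 0 ≤ a := Finset.sum_nonneg fun η _ => mul_nonneg (gibbs_pos β η).le (hTH η).1
  have ha1 : a ≤ ((n : ℝ) + 1) ^ 2 := by
    calc a ≤ ∑ η : Config n, gibbs β n η * ((n : ℝ) + 1) ^ 2 :=
          Finset.sum_le_sum fun η _ => mul_le_mul_of_nonneg_left (hTH η).2 (gibbs_pos β η).le
      _ = _ := by rw [← Finset.sum_mul, sum_gibbs, one_mul]
  -- The centre a is the Gibbs mean, not the mean over loops; this is why the area bound holds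
  -- around every a in [0, (n + 1) ^ 2].
  have hvar := h₁ n ((le_max_left _ _).trans hn) htall a ha0 ha1
  have hexc := sum_loops_le_mul_sum_excursions (n := n) β (G := fun σ => ((area σ : ℝ) - a) ^ 2)
    (fun c σ => by simp only [area_rot]) fun _ => sq_nonneg _
  have hZ := mul_partitionFunction_le hβ hfree
  have hpf := partitionFunction_pos β n
  have hsum := sum_gibbs_mul (β := β) (n := n) fun σ => ((area σ : ℝ) - a) ^ 2
  simp only [area_toLoop] at hsum
  rw [hsum, le_div_iff₀ hpf]
  set Z := ∑ σ ∈ loops n n, loopWeight β σ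
  set E := Real.exp (2 * β)
  have hE : 0 < E := Real.exp_pos _
  have hN : (0 : ℝ) < (n : ℝ) + 1 := by positivity
  refine le_of_mul_le_mul_left ?_ hN
  calc ((n : ℝ) + 1) * (c / (2 * E) * n ^ 3 * partitionFunction β n)
      = c / (2 * E) * n ^ 3 * ((n + 1) * partitionFunction β n) := by ring
    _ ≤ c / (2 * E) * ((n : ℝ) + 1) ^ 3 * (2 * E * Z) := by
        gcongr
        linarith
    _ = c * ((n : ℝ) + 1) ^ 3 * Z := by field_simp
    _ ≤ _ := hvar.trans hexc

/-- Under the Gibbs distribution the mean squared height difference is of order `1`. -/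
lemma exists_sum_sq_le {β : ℝ} (hβ : 0 < β) : ∃ C : ℝ, 0 < C ∧ ∃ n₀ : ℕ, ∀ n ≥ n₀, 1 ≤ n →
    ∑ η : Config n, gibbs β n η *
      ∑ i : Fin n, (((η i).val : ℝ) - (height η i.val : ℝ)) ^ 2 ≤ n * C := by
  obtain ⟨C, hC0, hC⟩ := exists_sum_pow_mul_exp_le 1 hβ
  obtain ⟨q, hq0, hq⟩ := exists_stepMass_le hβ
  obtain ⟨n₂, h₂⟩ := exists_freeMass_bounds hβ zero_lt_one
  refine ⟨4 * Real.exp (2 * β) * C * q, by positivity, n₂, fun n hn hn1 => ?_⟩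
  obtain ⟨hfree, -⟩ := h₂ n hn
  have hexc := mul_sum_excursions_le (n := n) hβ (G := fun σ => (sqSteps σ : ℝ))
    (fun c σ => by simp only [sqSteps_rot])
    (fun σ => by
      have : 0 ≤ sqSteps σ := Finset.sum_nonneg fun i _ => sq_nonneg _
      exact_mod_cast this)
    fun σ hσ => by exact_mod_cast sqSteps_le_raiseOff hσ
  -- Pushing the root down may raise the height differences to n + 1, hence the passage through
  -- closed walks.
  have hF := sum_sqSteps_le (β := β) (hC (n + 1))
  have hB := sum_loops_le_mul_partitionFunction (β := β) (n := n)
  have hpf := partitionFunction_pos β n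
  have hfm := freeMass_nonneg (β := β) (n := n)
  have hn1' : (1 : ℝ) ≤ n := by exact_mod_cast hn1
  have hN : (0 : ℝ) < (n : ℝ) + 1 := by positivity
  calc _ ≤ ∑ η : Config n, gibbs β n η * (sqSteps (toLoop η) : ℝ) :=
        Finset.sum_le_sum fun η _ =>
          mul_le_mul_of_nonneg_left (sum_sq_sub_height_le η) (gibbs_pos β η).le
    _ = _ := sum_gibbs_mul (β := β) (n := n) fun σ => (sqSteps σ : ℝ)
    _ ≤ _ := by
        rw [div_le_iff₀ hpf]
        refine le_of_mul_le_mul_left (hexc.trans ?_) hN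
        set E := Real.exp (2 * β)
        have hE : 0 < E := Real.exp_pos _
        have hfm2 : freeMass β n ≤ 2 * ((n + 1) * partitionFunction β n) := by linarith
        calc _ ≤ E * (((n : ℝ) + 1) * (C * (stepMass β (n + 1) * freeMass β n))) := by gcongr
          _ ≤ E * (((n : ℝ) + 1) * (C * (q * (2 * ((n + 1) * partitionFunction β n))))) := by
              gcongr
              exact hq _
          _ ≤ E * (((n : ℝ) + 1) * (C * (q * (2 * ((n + n) * partitionFunction β n))))) := by
              gcongr
          _ = _ := by ring

lemma ofReal_le_mixingTime {Ω : Type*} [Fintype Ω] [DecidableEq Ω] {P : Matrix Ω Ω ℝ} {π : Ω → ℝ}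
    {x : ℝ} (h : ∀ t : ℕ, (∀ ξ, tvDist ((P ^ t) ξ) π ≤ 1 / (2 * Real.exp 1)) → x ≤ t) :
    ENNReal.ofReal x ≤ ((mixingTime P π : ℕ∞) : ENNReal) := by
  have h1 : ((⌈x⌉₊ : ℕ) : ℕ∞) ≤ mixingTime P π := by
    unfold mixingTime hitAccuracy
    refine le_iInf₂ fun t ht => ?_
    exact_mod_cast Nat.ceil_le.2 (h t ht)
  calc ENNReal.ofReal x ≤ ENNReal.ofReal (⌈x⌉₊ : ℕ) := ENNReal.ofReal_le_ofReal (Nat.le_ceil x)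
    _ = (((⌈x⌉₊ : ℕ) : ℕ∞) : ENNReal) := by simp
    _ ≤ _ := ENat.toENNReal_le.2 h1

lemma nontrivial_config {n : ℕ} (hn : 1 ≤ n) : Nontrivial (Config n) := by
  have : Nonempty (Fin n) := ⟨⟨0, hn⟩⟩
  have : Nontrivial (Fin (n + 1)) := Fin.nontrivial_iff_two_le.2 (by omega)
  exact Function.nontrivial

end Final

end SOS

/-- Both dynamics have mixing time `Ω(n ^ 3)`, for every fixed inverse temperature. -/
theorem theorem6 (β : ℝ) (hβ : 0 < β) :
    ∃ c : ℝ, 0 < c ∧ ∀ n : ℕ, 1 ≤ n →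
      ENNReal.ofReal (c * (n : ℝ) ^ 3)
          ≤ ((SOS.mixingTime (SOS.column β n) (SOS.gibbs β n) : ℕ∞) : ENNReal) ∧
      ENNReal.ofReal (c * (n : ℝ) ^ 3)
          ≤ ((SOS.mixingTime (SOS.singleSite β n) (SOS.gibbs β n) : ℕ∞) : ENNReal) := by
  obtain ⟨c₁, hc₁, n₁, h₁⟩ := SOS.exists_variance_totalHeight_ge hβ
  obtain ⟨C, hC, n₂, h₂⟩ := SOS.exists_sum_sq_le hβ
  set D := max 1 (4 * C) with hD
  have hD0 : 0 < D := lt_of_lt_of_le one_pos (le_max_left _ _)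
  set N := max n₁ n₂ with hN
  have key : ∀ n : ℕ, 1 ≤ n → ∀ P : Matrix (SOS.Config n) (SOS.Config n) ℝ,
      SOS.IsReversibleChain P (SOS.gibbs β n) →
      (N ≤ n → ∑ x, ∑ y, SOS.gibbs β n x * P x y *
        (SOS.totalHeight x - SOS.totalHeight y) ^ 2 ≤ D) →
      -- The second term of the minimum handles n < N, where the claimed bound is at most 1 and it
      -- suffices that the chain is not mixed at time 0.
      ENNReal.ofReal (min (c₁ / D) (1 / ((N : ℝ) + 1) ^ 3) * (n : ℝ) ^ 3)
        ≤ ((SOS.mixingTime P (SOS.gibbs β n) : ℕ∞) : ENNReal) := by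
    intro n hn P hP hdir
    refine SOS.ofReal_le_mixingTime fun t ht => ?_
    have ht1 : 1 ≤ t := by
      rcases Nat.eq_zero_or_pos t with h0 | h0
      · subst h0
        have := SOS.nontrivial_config hn
        exact (hP.not_mixed_zero ht).elim
      · exact h0
    have ht1' : (1 : ℝ) ≤ t := by exact_mod_cast ht1
    rcases le_or_gt N n with hNn | hNn
    · have hvar := hP.variance_le_mul_time SOS.totalHeight (hdir hNn) ht1 ht
      have hlow := h₁ n ((le_max_left _ _).trans hNn)
      calc _ ≤ c₁ / D * (n : ℝ) ^ 3 := by gcongr; exact min_le_left _ _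
        _ = (c₁ * (n : ℝ) ^ 3) / D := by ring
        _ ≤ t := by
            rw [div_le_iff₀ hD0]
            linarith
    · have hnN : (n : ℝ) ≤ (N : ℝ) + 1 := by
        have : (n : ℝ) < N := by exact_mod_cast hNn
        linarith
      calc _ ≤ 1 / ((N : ℝ) + 1) ^ 3 * (n : ℝ) ^ 3 := by gcongr; exact min_le_right _ _
        _ ≤ 1 / ((N : ℝ) + 1) ^ 3 * ((N : ℝ) + 1) ^ 3 := by gcongr
        _ = 1 := by field_simp
        _ ≤ t := ht1'
  refine ⟨min (c₁ / D) (1 / ((N : ℝ) + 1) ^ 3), lt_min (by positivity) (by positivity),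
    fun n hn => ⟨?_, ?_⟩⟩
  · refine key n hn _ (SOS.column_isReversibleChain β hn) fun hNn => ?_
    exact (SOS.column_dirichlet_le β hn (h₂ n ((le_max_right _ _).trans hNn) hn)).trans
      (le_max_right _ _)
  · refine key n hn _ (SOS.singleSite_isReversibleChain β hβ hn) fun _ => ?_
    exact (SOS.singleSite_dirichlet_le β hβ hn).trans (le_max_left _ _)
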